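/- Let $L>0$, let $q\in L_2[0,L]$ be complex valued and let $H\in\mathbb C$. For $\rho\in\mathbb C$ let $T(\rho,\cdot)$ and $\psi(\rho,\cdot)$ be the solutions on $[0,L]$ of $$-y''+q(x)\,y=\rho^2y$$ ($y'$ absolutely continuous, equation satisfied almost everywhere) with $$T(\rho,L)=0,\quad T'(\rho,L)=1,\qquad \psi(\rho,L)=1,\quad \psi'(\rho,L)=-H .$$ Write $\operatorname{sinc}(z)=\frac{\sin \pi z}{\pi z}$ for $z\ne0$, $\operatorname{sinc}(0)=1$, and let $j_1(z)=\frac{\sin z}{z^2}-\frac{\cos z}{z}$, $j_1(0)=0$, be the spherical Bessel function of order $1$. Then for every $x\in[0,L)$ and every $\rho\in\mathbb C$ $$T(\rho,x)=\frac{\sin(\rho(x-L))}{\rho}+\frac{1}{2\rho\sin(\rho(x-L))}\sum_{n=0}^{\infty}t_n(x)\left(\operatorname{sinc}\Big(\frac{2\rho(x-L)}{\pi}-2n-1\Big)+\operatorname{sinc}\Big(\frac{2\rho(x-L)}{\pi}+2n+1\Big)\right),$$ $$t_n(x)=\frac{(-1)^n(2n+1)\pi}{x-L}\,T\Big(\frac{2n+1}{2(x-L)}\pi,x\Big)-2,\qquad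 n=0,1,\dots,$$ where at the zeros of $\rho\sin(\rho(x-L))$ the quotient $\frac{\sin(\rho(x-L))}{\rho}$ and each term of the series, with the factor $\frac1{2\rho\sin(\rho(x-L))}$ included in it, are understood as their limits (the singularities are removable), and $$\psi(\rho,x)=\rho(x-L)\,j_1(\rho(L-x))+\sum_{n=0}^{\infty}\psi_n(x)\left(\operatorname{sinc}\Big(\frac{\rho(x-L)}{\pi}-n\Big)+\operatorname{sinc}\Big(\frac{\rho(x-L)}{\pi}+n\Big)\right),$$ $$\psi_0(x)=\frac{\psi(0,x)}2,\qquad \psi_n(x)=\psi\Big(\frac{n\pi}{x-L},x\Big)-(-1)^n,\quad n=1,2,\dots.$$ For each fixed $x\in[0,L)$ these series (the series for $T$ both with and without the factor $\frac1{2\rho\sin(\rho(x-L))}$ in its terms) converge uniformly in $\rho$ on every compact subset of $\mathbb C$; for $\rho$ on the real line they converge in the norm of $L_2(\mathbb R)$, absolutely and uniformly. -/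

import Mathlib

open Filter Topology MeasureTheory Set

noncomputable section

namespace SturmLiouville

/-- `y` is a (Carathéodory) solution of `-y'' + q y = ρ² y` on `[0, L]`: `y` is differentiable on
`[0, L]` (one-sidedly at the endpoints), `y'` is absolutely continuous on `[0, L]`, and the equation
holds almost everywhere. -/
structure IsSolution (q : ℝ → ℂ) (L : ℝ) (ρ : ℂ) (y : ℝ → ℂ) : Prop where
  differentiableOn : DifferentiableOn ℝ y (Icc 0 L)
  absolutelyContinuous_deriv :
    AbsolutelyContinuousOnInterval (derivWithin y (Icc 0 L)) 0 L
  equation : ∀ᵐ x ∂(volume.restrict (Icc 0 L)),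
    -derivWithin (derivWithin y (Icc 0 L)) (Icc 0 L) x + q x * y x = ρ ^ 2 * y x

/-- `T(ρ, ·)` is, for every `ρ`, the solution with `T(ρ, L) = 0`, `T'(ρ, L) = 1`. -/
def IsSolutionT (q : ℝ → ℂ) (L : ℝ) (T : ℂ → ℝ → ℂ) : Prop :=
  ∀ ρ : ℂ, IsSolution q L ρ (T ρ) ∧ T ρ L = 0 ∧ derivWithin (T ρ) (Icc 0 L) L = 1

/-- `ψ(ρ, ·)` is, for every `ρ`, the solution with `ψ(ρ, L) = 1`, `ψ'(ρ, L) = -H`. -/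
def IsSolutionPsi (q : ℝ → ℂ) (L : ℝ) (H : ℂ) (ψ : ℂ → ℝ → ℂ) : Prop :=
  ∀ ρ : ℂ, IsSolution q L ρ (ψ ρ) ∧ ψ ρ L = 1 ∧ derivWithin (ψ ρ) (Icc 0 L) L = -H

/-- The normalized sinc function on `ℂ`. -/
def sinc (z : ℂ) : ℂ :=
  if z = 0 then 1 else Complex.sin (Real.pi * z) / (Real.pi * z)

/-- The spherical Bessel function `j₁`. -/
def sphericalJ1 (z : ℂ) : ℂ :=
  if z = 0 then 0 else Complex.sin z / z ^ 2 - Complex.cos z / z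

/-- The value at `z` of `f` with its removable singularities removed, `lim_{w → z, w ≠ z} f w`. -/
def limitValue (f : ℂ → ℂ) (z : ℂ) : ℂ :=
  limUnder (𝓝[≠] z) f

/-- The coefficients `t_n(x)`. -/
def coeffT (L : ℝ) (T : ℂ → ℝ → ℂ) (n : ℕ) (x : ℝ) : ℂ :=
  (-1) ^ n * (2 * n + 1) * Real.pi / (x - L)
    * T ((2 * n + 1) / (2 * (x - L)) * Real.pi) x - 2

/-- The coefficients `ψ_n(x)`. -/
def coeffPsi (L : ℝ) (ψ : ℂ → ℝ → ℂ) (n : ℕ) (x : ℝ) : ℂ :=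
  if n = 0 then ψ 0 x / 2 else ψ (n * Real.pi / (x - L)) x - (-1) ^ n

/-- `sinc(2ρ(x - L)/π - 2n - 1) + sinc(2ρ(x - L)/π + 2n + 1)`. -/
def sincPairT (L x : ℝ) (n : ℕ) (ρ : ℂ) : ℂ :=
  sinc (2 * ρ * (x - L) / Real.pi - 2 * n - 1) + sinc (2 * ρ * (x - L) / Real.pi + 2 * n + 1)

/-- `sinc(ρ(x - L)/π - n) + sinc(ρ(x - L)/π + n)`. -/
def sincPairPsi (L x : ℝ) (n : ℕ) (ρ : ℂ) : ℂ :=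
  sinc (ρ * (x - L) / Real.pi - n) + sinc (ρ * (x - L) / Real.pi + n)

/-- The series `∑ u_n` of functions of `ρ ∈ ℂ` converges to `F` uniformly on every compact subset
of `ℂ` and, for `ρ` on the real line, in the norm of `L₂(ℝ)`, absolutely and uniformly. -/
structure ConvergesAsCardinalSeries (u : ℕ → ℂ → ℂ) (F : ℂ → ℂ) : Prop where
  uniformly_on_compacts : ∀ K : Set ℂ, IsCompact K →
    TendstoUniformlyOn (fun N ρ => ∑ n ∈ Finset.range N, u n ρ) F atTop K
  term_memLp : ∀ n, MemLp (fun r : ℝ => u n (r : ℂ)) 2 volume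
  sum_memLp : MemLp (fun r : ℝ => F (r : ℂ)) 2 volume
  in_L2_norm : Tendsto
    (fun N => eLpNorm (fun r : ℝ => ∑ n ∈ Finset.range N, u n (r : ℂ) - F (r : ℂ)) 2 volume)
    atTop (𝓝 0)
  absolutely_on_real : ∀ r : ℝ, Summable (fun n => ‖u n (r : ℂ)‖)
  uniformly_on_real :
    TendstoUniformly (fun N (r : ℝ) => ∑ n ∈ Finset.range N, u n (r : ℂ))
      (fun r : ℝ => F (r : ℂ)) atTop

end SturmLiouville

end

namespace SturmLiouville

/-! Fix `x < L` and put `b = x - L`. As functions of `ρ`, `T` and `ψ` are even and entire, and both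
`ψ - cos (ρ b)` and `ρ T - sin (ρ b)` are of order `exp (|Im ρ| |b|) / (1 + |ρ|)`. The bounds come
from the Volterra equation (`IsSolution.volterra`) and a weighted maximum argument
(`exists_solution_bound`, `exists_remainder_bound`). For analyticity, `T` and `ψ` form a fundamental
system with Wronskian one, and a solution at `μ` equals a constant plus `μ ^ 2 - ρ ^ 2` times an
integral (`solution_eq_of_fundamental_system`); this gives evenness at once, and the derivative at
`ρ` as soon as the integral is continuous in `μ`.

After rescaling, these remainders give even entire functions bounded by `C exp (π |Im z|) / (1 +
|z|)`, to which the sampling theorem `eq_tsum_sinc` applies. The samples are `O(1 / n)`, so the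
terms are dominated by `1 / (n (1 + ||z| - n|))` up to the exponential, and `exists_tail_bound`
yields every mode of convergence from this. The function minus its series vanishes at all integers;
divided by `sin (π z)` it is entire and small on large squares, hence zero
(`eq_zero_of_zero_at_int`).

For `ψ` the sampled function is `ψ - cos + sinc`; the added `sinc` turns the cosine into the Bessel
term. For `T` it is `2 sin (ρ b) (ρ T - sin (ρ b))`: the sine doubles the exponential type and kills
the even nodes. Each remaining pair is divisible by `ρ sin (ρ b)` (`sinc_sub_add_sinc_add_odd`), the
divided terms obey a majorant of the same form, and the divided identity reaches the zeros of the
denominator by continuity. -/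

/-! ### Complex valued absolutely continuous functions. -/

lemma AbsolutelyContinuousOnInterval.comp_lipschitzWith_one {f : ℝ → ℂ} {g : ℂ → ℝ} {a b : ℝ}
    (hf : AbsolutelyContinuousOnInterval f a b) (hg : ∀ z w, dist (g z) (g w) ≤ dist z w) :
    AbsolutelyContinuousOnInterval (fun t => g (f t)) a b := by
  refine squeeze_zero (fun t => Finset.sum_nonneg fun i _ => dist_nonneg) (fun t => ?_) hf
  exact Finset.sum_le_sum fun i _ => hg _ _

lemma AbsolutelyContinuousOnInterval.complex_re {f : ℝ → ℂ} {a b : ℝ}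
    (hf : AbsolutelyContinuousOnInterval f a b) :
    AbsolutelyContinuousOnInterval (fun t => (f t).re) a b :=
  AbsolutelyContinuousOnInterval.comp_lipschitzWith_one hf fun z w => by
    rw [Real.dist_eq, dist_eq_norm, ← Complex.sub_re]
    exact Complex.abs_re_le_norm _

lemma AbsolutelyContinuousOnInterval.complex_im {f : ℝ → ℂ} {a b : ℝ}
    (hf : AbsolutelyContinuousOnInterval f a b) :
    AbsolutelyContinuousOnInterval (fun t => (f t).im) a b :=
  AbsolutelyContinuousOnInterval.comp_lipschitzWith_one hf fun z w => by
    rw [Real.dist_eq, dist_eq_norm, ← Complex.sub_im]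
    exact Complex.abs_im_le_norm _

/-- The fundamental theorem of calculus for complex valued absolutely continuous functions. -/
lemma AbsolutelyContinuousOnInterval.integral_eq_sub_of_ae_hasDerivAt {f φ : ℝ → ℂ} {a b : ℝ}
    (hab : a ≤ b) (hf : AbsolutelyContinuousOnInterval f a b)
    (hφ : ∀ᵐ t, t ∈ Ioo a b → HasDerivAt f (φ t) t) :
    IntervalIntegrable φ volume a b ∧ ∫ t in a..b, φ t = f b - f a := by
  have hIoo : ∀ᵐ t : ℝ, t ∈ uIoc a b → t ∈ Ioo a b := by
    have h : ∀ᵐ t : ℝ, t ≠ b := by simp [ae_iff]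
    filter_upwards [h] with t ht h2
    rw [uIoc_of_le hab] at h2
    exact ⟨h2.1, lt_of_le_of_ne h2.2 ht⟩
  have hre' : ∀ᵐ t, t ∈ uIoc a b → deriv (fun t => (f t).re) t = (φ t).re := by
    filter_upwards [hφ, hIoo] with t h1 h2 h3
    exact (Complex.reCLM.hasFDerivAt.comp_hasDerivAt t (h1 (h2 h3))).deriv
  have him' : ∀ᵐ t, t ∈ uIoc a b → deriv (fun t => (f t).im) t = (φ t).im := by
    filter_upwards [hφ, hIoo] with t h1 h2 h3
    exact (Complex.imCLM.hasFDerivAt.comp_hasDerivAt t (h1 (h2 h3))).deriv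
  have hr := AbsolutelyContinuousOnInterval.complex_re hf
  have hi := AbsolutelyContinuousOnInterval.complex_im hf
  have hr1 : IntervalIntegrable (fun t => (φ t).re) volume a b :=
    hr.intervalIntegrable_deriv.congr_ae ((ae_restrict_iff' measurableSet_uIoc).2 hre')
  have hi1 : IntervalIntegrable (fun t => (φ t).im) volume a b :=
    hi.intervalIntegrable_deriv.congr_ae ((ae_restrict_iff' measurableSet_uIoc).2 him')
  have hr2 : ∫ t in a..b, (φ t).re = (f b).re - (f a).re := by
    rw [← hr.integral_deriv_eq_sub]
    refine intervalIntegral.integral_congr_ae ?_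
    filter_upwards [hre'] with t h1 h2 using (h1 h2).symm
  have hi2 : ∫ t in a..b, (φ t).im = (f b).im - (f a).im := by
    rw [← hi.integral_deriv_eq_sub]
    refine intervalIntegral.integral_congr_ae ?_
    filter_upwards [him'] with t h1 h2 using (h1 h2).symm
  have hint : IntervalIntegrable φ volume a b := by
    have h1 : IntervalIntegrable (fun t => ((φ t).re : ℂ) + ((φ t).im : ℂ) * Complex.I)
        volume a b := by
      rw [intervalIntegrable_iff] at hr1 hi1 ⊢
      exact hr1.ofReal.add (hi1.ofReal.mul_const _)
    simpa only [Complex.re_add_im] using h1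
  refine ⟨hint, ?_⟩
  have e : ∫ t in a..b, φ t
      = ∫ t in a..b, (((φ t).re : ℂ) + ((φ t).im : ℂ) * Complex.I) := by
    simp only [Complex.re_add_im]
  rw [e, intervalIntegral.integral_add, intervalIntegral.integral_mul_const,
    intervalIntegral.integral_ofReal, intervalIntegral.integral_ofReal, hr2, hi2]
  · apply Complex.ext <;> simp
  · rw [intervalIntegrable_iff] at hr1 ⊢
    exact hr1.ofReal
  · rw [intervalIntegrable_iff] at hi1 ⊢
    exact hi1.ofReal.mul_const _

/-! ### Carathéodory solutions and Lagrange's identity. -/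

section Solution

variable {q q₁ q₂ : ℝ → ℂ} {L : ℝ} {ρ ρ₁ ρ₂ : ℂ} {y y₁ y₂ : ℝ → ℂ}

lemma IsSolution.continuousOn (h : IsSolution q L ρ y) : ContinuousOn y (Icc 0 L) :=
  h.differentiableOn.continuousOn

lemma IsSolution.continuousOn_deriv (hL : 0 < L) (h : IsSolution q L ρ y) :
    ContinuousOn (derivWithin y (Icc 0 L)) (Icc 0 L) := by
  simpa [uIcc_of_le hL.le] using h.absolutelyContinuous_deriv.continuousOn

lemma IsSolution.absolutelyContinuous (hL : 0 < L) (h : IsSolution q L ρ y) :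
    AbsolutelyContinuousOnInterval y 0 L := by
  apply ContDiffOn.absolutelyContinuousOnInterval
  rw [uIcc_of_le hL.le]
  have := (contDiffOn_succ_iff_derivWithin (𝕜 := ℝ) (n := 0) (f := y) (uniqueDiffOn_Icc hL)).2
    ⟨h.differentiableOn, by simp, contDiffOn_zero.2 (h.continuousOn_deriv hL)⟩
  simpa using this

lemma IsSolution.hasDerivAt (h : IsSolution q L ρ y) {t : ℝ} (ht : t ∈ Ioo 0 L) :
    HasDerivAt y (derivWithin y (Icc 0 L) t) t :=
  (h.differentiableOn t (Ioo_subset_Icc_self ht)).hasDerivWithinAt.hasDerivAt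
    (Icc_mem_nhds ht.1 ht.2)

/-- The equation alone is not enough, since `derivWithin` is zero by default where no derivative
exists. Absolute continuity gives bounded variation, hence genuine differentiability almost
everywhere. -/
lemma IsSolution.ae_hasDerivAt_deriv (hL : 0 < L) (h : IsSolution q L ρ y) :
    ∀ᵐ t, t ∈ Ioo 0 L →
      HasDerivAt (derivWithin y (Icc 0 L)) ((q t - ρ ^ 2) * y t) t := by
  have h1 := h.absolutelyContinuous_deriv.boundedVariationOn.ae_differentiableAt_of_mem_uIcc
  have h2 := (ae_restrict_iff' measurableSet_Icc).1 h.equation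
  filter_upwards [h1, h2] with t h1 h2 ht
  have ht' := Ioo_subset_Icc_self ht
  have h3 := (h1 (by rwa [uIcc_of_le hL.le])).hasDerivAt
  have h4 : derivWithin (derivWithin y (Icc 0 L)) (Icc 0 L) t = (q t - ρ ^ 2) * y t := by
    linear_combination -h2 ht'
  rwa [← h4, derivWithin_of_mem_nhds (Icc_mem_nhds ht.1 ht.2)]

/-- Lagrange's identity for two equations. -/
lemma IsSolution.lagrange (hL : 0 < L) (h₁ : IsSolution q₁ L ρ₁ y₁) (h₂ : IsSolution q₂ L ρ₂ y₂)
    {x : ℝ} (hx : x ∈ Icc 0 L) :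
    IntervalIntegrable (fun t => ((q₂ t - ρ₂ ^ 2) - (q₁ t - ρ₁ ^ 2)) * (y₁ t * y₂ t))
      volume x L ∧
    ∫ t in x..L, ((q₂ t - ρ₂ ^ 2) - (q₁ t - ρ₁ ^ 2)) * (y₁ t * y₂ t)
      = (y₁ L * derivWithin y₂ (Icc 0 L) L - derivWithin y₁ (Icc 0 L) L * y₂ L)
        - (y₁ x * derivWithin y₂ (Icc 0 L) x - derivWithin y₁ (Icc 0 L) x * y₂ x) := by
  have hac : AbsolutelyContinuousOnInterval
      (fun t => y₁ t * derivWithin y₂ (Icc 0 L) t - derivWithin y₁ (Icc 0 L) t * y₂ t) x L := by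
    have h := ((h₁.absolutelyContinuous hL).smul h₂.absolutelyContinuous_deriv).sub
      (h₁.absolutelyContinuous_deriv.smul (h₂.absolutelyContinuous hL))
    refine AbsolutelyContinuousOnInterval.mono h ?_
    rw [uIcc_of_le hL.le, uIcc_of_le hx.2]
    exact Icc_subset_Icc_left hx.1
  refine AbsolutelyContinuousOnInterval.integral_eq_sub_of_ae_hasDerivAt hx.2 hac ?_
  filter_upwards [h₁.ae_hasDerivAt_deriv hL, h₂.ae_hasDerivAt_deriv hL] with t h3 h4 ht
  have ht' : t ∈ Ioo 0 L := ⟨hx.1.trans_lt ht.1, ht.2⟩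
  refine (((h₁.hasDerivAt ht').mul (h4 ht')).sub ((h3 ht').mul (h₂.hasDerivAt ht'))).congr_deriv ?_
  ring

end Solution

/-! ### The unperturbed kernel and its exponential bounds. -/

/-- `sin (ρ u) / ρ`, with its value `u` at `ρ = 0`. -/
noncomputable def sinOver (ρ : ℂ) (u : ℝ) : ℂ :=
  if ρ = 0 then u else Complex.sin (ρ * u) / ρ

lemma hasDerivAt_sinOver (ρ : ℂ) (u : ℝ) :
    HasDerivAt (sinOver ρ) (Complex.cos (ρ * u)) u := by
  unfold sinOver
  by_cases h : ρ = 0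
  · simpa [h] using (hasDerivAt_id u).ofReal_comp
  · simp only [h, if_false]
    have h1 : HasDerivAt (fun u : ℝ => ρ * (u : ℂ)) (ρ * 1) u :=
      ((hasDerivAt_id u).ofReal_comp).const_mul ρ
    refine (((Complex.hasDerivAt_sin _).scomp u h1).div_const ρ).congr_deriv ?_
    rw [smul_eq_mul]
    field_simp

lemma mul_sinOver (ρ : ℂ) (u : ℝ) : ρ * sinOver ρ u = Complex.sin (ρ * u) := by
  unfold sinOver
  split_ifs with h
  · simp [h]
  · field_simp

lemma norm_cos_le_exp (z : ℂ) : ‖Complex.cos z‖ ≤ Real.exp |z.im| := by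
  rw [Complex.cos, norm_div, Complex.norm_ofNat, div_le_iff₀ (by norm_num)]
  refine (norm_add_le _ _).trans ?_
  rw [Complex.norm_exp, Complex.norm_exp]
  have h1 : Real.exp (z * Complex.I).re ≤ Real.exp |z.im| := by
    apply Real.exp_le_exp.2; simpa using neg_le_abs z.im
  have h2 : Real.exp (-z * Complex.I).re ≤ Real.exp |z.im| := by
    apply Real.exp_le_exp.2; simpa using le_abs_self z.im
  linarith

lemma norm_sin_le_exp (z : ℂ) : ‖Complex.sin z‖ ≤ Real.exp |z.im| := by
  rw [← Complex.cos_sub_pi_div_two]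
  refine (norm_cos_le_exp _).trans (le_of_eq ?_)
  simp

lemma norm_sinOver_le (ρ : ℂ) (u : ℝ) :
    ‖sinOver ρ u‖ ≤ |u| * Real.exp (|ρ.im| * |u|) := by
  have hd : ∀ v ∈ Icc (-|u|) |u|,
      HasDerivWithinAt (sinOver ρ) (Complex.cos (ρ * v)) (Icc (-|u|) |u|) v :=
    fun v _ => (hasDerivAt_sinOver ρ v).hasDerivWithinAt
  have hb : ∀ v ∈ Icc (-|u|) |u|, ‖Complex.cos (ρ * v)‖ ≤ Real.exp (|ρ.im| * |u|) := by
    intro v hv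
    refine (norm_cos_le_exp _).trans (Real.exp_le_exp.2 ?_)
    have : (ρ * (v : ℂ)).im = ρ.im * v := by simp [Complex.mul_im]
    rw [this, abs_mul]
    exact mul_le_mul_of_nonneg_left (abs_le.2 hv) (abs_nonneg _)
  have := (convex_Icc (-|u|) |u|).norm_image_sub_le_of_norm_hasDerivWithin_le hd hb
    (x := 0) (y := u) ⟨by simp, by simp⟩ (abs_le.1 le_rfl)
  have h0 : sinOver ρ 0 = 0 := by simp [sinOver]
  rw [h0, sub_zero, sub_zero, Real.norm_eq_abs] at this
  linarith

lemma norm_mul_sinOver_le (ρ : ℂ) (u : ℝ) :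
    ‖ρ‖ * ‖sinOver ρ u‖ ≤ Real.exp (|ρ.im| * |u|) := by
  rw [← norm_mul, mul_sinOver]
  refine (norm_sin_le_exp _).trans (le_of_eq ?_)
  have : (ρ * (u : ℂ)).im = ρ.im * u := by simp [Complex.mul_im]
  rw [this, abs_mul]

/-- One of the two preceding bounds is good for small `ρ`, the other for large `ρ`; their sum covers
both regimes without a case split. -/
lemma one_add_norm_mul_norm_sinOver_le {ρ : ℂ} {u L : ℝ} (hu : |u| ≤ L) :
    (1 + ‖ρ‖) * ‖sinOver ρ u‖ ≤ (L + 1) * Real.exp (|ρ.im| * |u|) := by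
  have h1 := norm_sinOver_le ρ u
  have h2 := norm_mul_sinOver_le ρ u
  have h3 := mul_le_mul_of_nonneg_right hu (Real.exp_pos (|ρ.im| * |u|)).le
  linarith

/-- `t ↦ sin (ρ (x - t)) / ρ` solves the equation with zero potential. -/
lemma isSolution_sinOver {L : ℝ} (hL : 0 < L) (ρ : ℂ) (x : ℝ) :
    IsSolution 0 L ρ (fun t => sinOver ρ (x - t)) ∧
    ∀ t ∈ Icc 0 L, derivWithin (fun t => sinOver ρ (x - t)) (Icc 0 L) t
      = -Complex.cos (ρ * ((x - t : ℝ) : ℂ)) := by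
  have hd : ∀ t : ℝ, HasDerivAt (fun t => sinOver ρ (x - t))
      (-Complex.cos (ρ * ((x - t : ℝ) : ℂ))) t := by
    intro t
    have := (hasDerivAt_sinOver ρ (x - t)).scomp t ((hasDerivAt_id t).const_sub x)
    refine this.congr_deriv (by simp)
  have hdw : ∀ t ∈ Icc 0 L, derivWithin (fun t => sinOver ρ (x - t)) (Icc 0 L) t
      = -Complex.cos (ρ * ((x - t : ℝ) : ℂ)) := fun t ht =>
    (hd t).hasDerivWithinAt.derivWithin (uniqueDiffOn_Icc hL t ht)
  have hd2 : ∀ t : ℝ, HasDerivAt (fun t : ℝ => -Complex.cos (ρ * ((x - t : ℝ) : ℂ)))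
      (-ρ ^ 2 * sinOver ρ (x - t)) t := by
    intro t
    have h1 : HasDerivAt (fun t : ℝ => ρ * ((x - t : ℝ) : ℂ)) (ρ * (-1)) t := by
      have := ((hasDerivAt_id t).const_sub x).ofReal_comp.const_mul ρ
      simpa using this
    refine ((Complex.hasDerivAt_cos _).scomp t h1).neg.congr_deriv ?_
    rw [← mul_sinOver, smul_eq_mul]
    ring
  refine ⟨⟨fun t _ => (hd t).differentiableAt.differentiableWithinAt, ?_, ?_⟩, hdw⟩
  · apply ContDiffOn.absolutelyContinuousOnInterval
    rw [uIcc_of_le hL.le]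
    refine ContDiffOn.congr (f := fun t : ℝ => -Complex.cos (ρ * ((x - t : ℝ) : ℂ))) ?_ hdw
    apply ContDiff.contDiffOn
    have h1 : ContDiff ℝ 1 (fun t : ℝ => ((x - t : ℝ) : ℂ)) :=
      Complex.ofRealCLM.contDiff.comp (contDiff_const.sub contDiff_id)
    exact ((Complex.contDiff_cos.restrict_scalars ℝ).comp (contDiff_const.mul h1)).neg
  · rw [ae_restrict_iff' measurableSet_Icc]
    refine Eventually.of_forall fun t ht => ?_
    rw [derivWithin_congr hdw (hdw t ht),
      (hd2 t).hasDerivWithinAt.derivWithin (uniqueDiffOn_Icc hL t ht)]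
    simp

/-! ### Growth and asymptotics in the spectral parameter. -/

section Estimates

variable {q : ℝ → ℂ} {L : ℝ} {ρ : ℂ} {y : ℝ → ℂ}

/-- Variation of constants. -/
lemma IsSolution.volterra (hL : 0 < L) (h : IsSolution q L ρ y) {x : ℝ} (hx : x ∈ Icc 0 L) :
    y x = y L * Complex.cos (ρ * (x - L)) + derivWithin y (Icc 0 L) L * sinOver ρ (x - L)
      - ∫ t in x..L, q t * (y t * sinOver ρ (x - t)) := by
  obtain ⟨hs, hs'⟩ := isSolution_sinOver hL ρ x
  have h1 := (h.lagrange hL hs hx).2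
  have h2 : ∫ t in x..L, (((0 : ℝ → ℂ) t - ρ ^ 2) - (q t - ρ ^ 2)) * (y t * sinOver ρ (x - t))
      = -∫ t in x..L, q t * (y t * sinOver ρ (x - t)) := by
    rw [← intervalIntegral.integral_neg]
    congr 1; ext t; rw [Pi.zero_apply]; ring
  rw [h2, hs' L (right_mem_Icc.2 hL.le), hs' x hx] at h1
  have h0 : sinOver ρ (x - x) = 0 := by simp [sinOver]
  rw [h0] at h1
  simp only [sub_self, Complex.ofReal_zero, mul_zero, Complex.cos_zero, Complex.ofReal_sub] at h1
  linear_combination -h1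

lemma intervalIntegrable_norm_of_memLp (hq : MemLp q 2 (volume.restrict (Icc 0 L)))
    {x : ℝ} (hx : x ∈ Icc 0 L) :
    IntervalIntegrable (fun t => ‖q t‖) volume x L ∧
    IntervalIntegrable (fun t => ‖q t‖ ^ 2) volume x L := by
  have hsub : Ioc x L ⊆ Icc 0 L := fun t ht => ⟨hx.1.trans ht.1.le, ht.2⟩
  constructor
  · rw [intervalIntegrable_iff_integrableOn_Ioc_of_le hx.2]
    exact ((hq.integrable (by norm_num)).norm).mono_measure (Measure.restrict_mono hsub le_rfl)
  · rw [intervalIntegrable_iff_integrableOn_Ioc_of_le hx.2]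
    exact (hq.integrable_norm_pow (by norm_num)).mono_measure (Measure.restrict_mono hsub le_rfl)

lemma integral_exp_neg_mul_le {γ : ℝ} (hγ : 0 < γ) (x L : ℝ) :
    ∫ t in x..L, Real.exp (-(γ * (t - x))) ≤ 1 / γ := by
  have hd : ∀ t ∈ uIcc x L, HasDerivAt (fun t => -(Real.exp (-(γ * (t - x))) / γ))
      (Real.exp (-(γ * (t - x)))) t := by
    intro t _
    have h1 : HasDerivAt (fun t => -(γ * (t - x))) (-(γ * 1)) t :=
      (((hasDerivAt_id t).sub_const x).const_mul γ).neg
    refine (h1.exp.div_const γ).neg.congr_deriv ?_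
    field_simp
  rw [intervalIntegral.integral_eq_sub_of_hasDerivAt hd
    (Continuous.intervalIntegrable (by fun_prop) _ _)]
  have : 0 ≤ Real.exp (-(γ * (L - x))) / γ := by positivity
  simp only [sub_self, mul_zero, neg_zero, Real.exp_zero]
  linarith

/-- An exponential weight that makes the Volterra operator with kernel `L ‖q‖` a contraction. -/
lemma exists_weight (hL : 0 < L) (hq : MemLp q 2 (volume.restrict (Icc 0 L))) :
    ∃ γ : ℝ, 0 < γ ∧ ∀ x ∈ Icc 0 L,
      ∫ t in x..L, L * ‖q t‖ * Real.exp (-(γ * (t - x))) ≤ 1 / 2 := by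
  set Q : ℝ := L ^ 2 * ∫ t in (0 : ℝ)..L, ‖q t‖ ^ 2 with hQ
  have hQ0 : 0 ≤ Q := mul_nonneg (sq_nonneg _)
    (intervalIntegral.integral_nonneg hL.le fun t _ => sq_nonneg _)
  -- The inequality of the two means splits the integrand into a `‖q‖ ^ 2` part and a purely
  -- exponential part. The latter contributes at most `1 / 4` for any `γ`; this `γ` makes the
  -- former, `Q / (2 * γ)`, at most `1 / 4` too.
  refine ⟨2 * (Q + 1), by positivity, fun x hx => ?_⟩
  set γ : ℝ := 2 * (Q + 1) with hγ
  have hγ0 : 0 < γ := by positivity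
  have hi := (intervalIntegrable_norm_of_memLp hq hx).2
  have hi0 := (intervalIntegrable_norm_of_memLp hq (left_mem_Icc.2 hL.le)).2
  have he : IntervalIntegrable (fun t => Real.exp (-(2 * γ * (t - x)))) volume x L :=
    Continuous.intervalIntegrable (by fun_prop) _ _
  have hpt : ∀ t, L * ‖q t‖ * Real.exp (-(γ * (t - x)))
      ≤ L ^ 2 / (2 * γ) * ‖q t‖ ^ 2 + γ / 2 * Real.exp (-(2 * γ * (t - x))) := by
    intro t
    have e : Real.exp (-(2 * γ * (t - x))) = Real.exp (-(γ * (t - x))) ^ 2 := by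
      rw [← Real.exp_nat_mul]; congr 1; push_cast; ring
    rw [e]
    have h2 : L ^ 2 / (2 * γ) * ‖q t‖ ^ 2 + γ / 2 * Real.exp (-(γ * (t - x))) ^ 2
      - L * ‖q t‖ * Real.exp (-(γ * (t - x)))
      = (L * ‖q t‖ - γ * Real.exp (-(γ * (t - x)))) ^ 2 / (2 * γ) := by
      field_simp; ring
    have h3 : 0 ≤ (L * ‖q t‖ - γ * Real.exp (-(γ * (t - x)))) ^ 2 / (2 * γ) := by positivity
    linarith
  have hint := (hi.const_mul (L ^ 2 / (2 * γ))).add (he.const_mul (γ / 2))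
  have hmono : ∫ t in x..L, ‖q t‖ ^ 2 ≤ ∫ t in (0 : ℝ)..L, ‖q t‖ ^ 2 :=
    intervalIntegral.integral_mono_interval hx.1 hx.2 le_rfl
      (Eventually.of_forall fun t => sq_nonneg _) hi0
  calc ∫ t in x..L, L * ‖q t‖ * Real.exp (-(γ * (t - x)))
      ≤ ∫ t in x..L, (L ^ 2 / (2 * γ) * ‖q t‖ ^ 2 + γ / 2 * Real.exp (-(2 * γ * (t - x)))) := by
        refine intervalIntegral.integral_mono_on hx.2 ?_ hint fun t _ => hpt t
        exact ((intervalIntegrable_norm_of_memLp hq hx).1.const_mul L).mul_continuousOn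
          (by fun_prop)
    _ = L ^ 2 / (2 * γ) * (∫ t in x..L, ‖q t‖ ^ 2)
        + γ / 2 * ∫ t in x..L, Real.exp (-(2 * γ * (t - x))) := by
        rw [intervalIntegral.integral_add (hi.const_mul _) (he.const_mul _),
          intervalIntegral.integral_const_mul, intervalIntegral.integral_const_mul]
    _ ≤ L ^ 2 / (2 * γ) * (∫ t in (0 : ℝ)..L, ‖q t‖ ^ 2) + γ / 2 * (1 / (2 * γ)) := by
        gcongr
        exact integral_exp_neg_mul_le (by positivity) x L
    _ = Q / (2 * γ) + 1 / 4 := by rw [hQ]; field_simp; ring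
    _ ≤ 1 / 4 + 1 / 4 := by
        have : Q / (2 * γ) ≤ 1 / 4 := by
          rw [div_le_iff₀ (by positivity), hγ]; linarith
        linarith
    _ = 1 / 2 := by norm_num

lemma norm_integral_volterra_le {x : ℝ} (hx : x ∈ Icc 0 L) {k : ℝ → ℝ}
    (hk : IntervalIntegrable k volume x L) {f : ℝ → ℂ}
    (hf : ∀ t ∈ Icc x L, ‖f t‖ ≤ k t) : ‖∫ t in x..L, f t‖ ≤ ∫ t in x..L, k t :=
  intervalIntegral.norm_integral_le_of_norm_le hx.2
    (Eventually.of_forall fun t ht => hf t (Ioc_subset_Icc_self ht)) hk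

/-- Solutions grow at most like the solution of the unperturbed equation, up to a constant
independent of the spectral parameter. -/
lemma exists_solution_bound (hL : 0 < L) (hq : MemLp q 2 (volume.restrict (Icc 0 L))) :
    ∃ M : ℝ, 0 < M ∧ ∀ (ρ : ℂ) (y : ℝ → ℂ) (c : ℝ), IsSolution q L ρ y →
      (∀ x ∈ Icc 0 L, ‖y L * Complex.cos (ρ * (x - L))
        + derivWithin y (Icc 0 L) L * sinOver ρ (x - L)‖ ≤ c * Real.exp (|ρ.im| * (L - x))) →
      ∀ x ∈ Icc 0 L, ‖y x‖ ≤ M * c * Real.exp (|ρ.im| * (L - x)) := by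
  obtain ⟨γ, hγ, hw⟩ := exists_weight hL hq
  refine ⟨2 * Real.exp (γ * L), by positivity, fun ρ y c hy hc x hx => ?_⟩
  set τ := |ρ.im| with hτ
  have hc0 : 0 ≤ c := by
    have := (norm_nonneg _).trans (hc L (right_mem_Icc.2 hL.le))
    simpa using this
  have hcont : ContinuousOn (fun t => ‖y t‖ * Real.exp (-((τ + γ) * (L - t)))) (Icc 0 L) :=
    hy.continuousOn.norm.mul (by fun_prop)
  -- The Volterra equation is evaluated only at the maximum of the weighted modulus. There the
  -- integral is at most half of the left side and is absorbed, which replaces Gronwall's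
  -- inequality.
  obtain ⟨x₀, hx₀, hmax⟩ := isCompact_Icc.exists_isMaxOn ⟨0, left_mem_Icc.2 hL.le⟩ hcont
  set m : ℝ := ‖y x₀‖ * Real.exp (-((τ + γ) * (L - x₀))) with hm
  have hm0 : 0 ≤ m := by positivity
  have hle : ∀ t ∈ Icc 0 L, ‖y t‖ ≤ m * Real.exp ((τ + γ) * (L - t)) := by
    intro t ht
    have h1 : ‖y t‖ * Real.exp (-((τ + γ) * (L - t))) ≤ m := hmax ht
    rwa [Real.exp_neg, ← div_eq_mul_inv, div_le_iff₀ (Real.exp_pos _)] at h1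
  set E : ℝ := Real.exp ((τ + γ) * (L - x₀)) with hE
  have hE0 : 0 < E := Real.exp_pos _
  have hmE : ‖y x₀‖ = m * E := by
    rw [hm, hE, mul_assoc, ← Real.exp_add]; simp
  have hkint : IntervalIntegrable (fun t => L * ‖q t‖ * Real.exp (-(γ * (t - x₀)))) volume x₀ L :=
    ((intervalIntegrable_norm_of_memLp hq hx₀).1.const_mul L).mul_continuousOn (by fun_prop)
  have hI : ‖∫ t in x₀..L, q t * (y t * sinOver ρ (x₀ - t))‖ ≤ m * E * (1 / 2) := by
    refine (norm_integral_volterra_le hx₀ (hkint.const_mul (m * E)) fun t ht => ?_).trans ?_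
    · have ht' : t ∈ Icc 0 L := ⟨hx₀.1.trans ht.1, ht.2⟩
      have ha : |x₀ - t| = t - x₀ := by rw [abs_of_nonpos (by linarith [ht.1])]; ring
      have h1 : ‖sinOver ρ (x₀ - t)‖ ≤ L * Real.exp (τ * (t - x₀)) := by
        have := norm_sinOver_le ρ (x₀ - t)
        rw [ha] at this
        refine this.trans (mul_le_mul_of_nonneg_right ?_ (Real.exp_pos _).le)
        linarith [ht.2, hx₀.1]
      calc ‖q t * (y t * sinOver ρ (x₀ - t))‖
          = ‖q t‖ * (‖y t‖ * ‖sinOver ρ (x₀ - t)‖) := by simp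
        _ ≤ ‖q t‖ * (m * Real.exp ((τ + γ) * (L - t)) * (L * Real.exp (τ * (t - x₀)))) := by
            gcongr
            exact hle t ht'
        _ = m * (Real.exp ((τ + γ) * (L - t)) * Real.exp (τ * (t - x₀))) * (L * ‖q t‖) := by ring
        _ = m * (E * Real.exp (-(γ * (t - x₀)))) * (L * ‖q t‖) := by
            rw [hE, ← Real.exp_add, ← Real.exp_add]; ring_nf
        _ = m * E * (L * ‖q t‖ * Real.exp (-(γ * (t - x₀)))) := by ring
    · rw [intervalIntegral.integral_const_mul]
      exact mul_le_mul_of_nonneg_left (hw x₀ hx₀) (by positivity)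
  have hv := hy.volterra hL hx₀
  have h3 : m * E ≤ c * Real.exp (τ * (L - x₀)) + m * E * (1 / 2) := by
    rw [← hmE]
    conv_lhs => rw [hv]
    refine (norm_sub_le _ _).trans ?_
    rw [hmE]
    exact add_le_add (hc x₀ hx₀) hI
  have h4 : m ≤ 2 * c := by
    have h5 : Real.exp (τ * (L - x₀)) ≤ E := by
      apply Real.exp_le_exp.2
      have := mul_nonneg hγ.le (sub_nonneg.2 hx₀.2)
      linarith
    have h6 : m * E ≤ 2 * c * E := by
      have := mul_le_mul_of_nonneg_left h5 hc0
      linarith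
    exact le_of_mul_le_mul_right h6 hE0
  calc ‖y x‖ ≤ m * Real.exp ((τ + γ) * (L - x)) := hle x hx
    _ = m * (Real.exp (γ * (L - x)) * Real.exp (τ * (L - x))) := by
        rw [← Real.exp_add]; ring_nf
    _ ≤ 2 * c * (Real.exp (γ * L) * Real.exp (τ * (L - x))) := by
        gcongr
        linarith [hx.1]
    _ = 2 * Real.exp (γ * L) * c * Real.exp (τ * (L - x)) := by ring

/-- The difference to the solution of the unperturbed equation gains a factor `1 / (1 + |ρ|)`. -/
lemma exists_remainder_bound (hL : 0 < L) (hq : MemLp q 2 (volume.restrict (Icc 0 L))) :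
    ∃ M : ℝ, 0 < M ∧ ∀ (ρ : ℂ) (y : ℝ → ℂ) (c : ℝ), IsSolution q L ρ y →
      (∀ x ∈ Icc 0 L, ‖y L * Complex.cos (ρ * (x - L))
        + derivWithin y (Icc 0 L) L * sinOver ρ (x - L)‖ ≤ c * Real.exp (|ρ.im| * (L - x))) →
      ∀ x ∈ Icc 0 L, (1 + ‖ρ‖) * ‖y x - (y L * Complex.cos (ρ * (x - L))
        + derivWithin y (Icc 0 L) L * sinOver ρ (x - L))‖
          ≤ M * c * Real.exp (|ρ.im| * (L - x)) := by
  obtain ⟨M, hM, hb⟩ := exists_solution_bound hL hq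
  set Q : ℝ := ∫ t in (0 : ℝ)..L, ‖q t‖
  have hQ0 : 0 ≤ Q := intervalIntegral.integral_nonneg hL.le fun t _ => norm_nonneg _
  refine ⟨(L + 1) * M * (Q + 1), by positivity, fun ρ y c hy hc x hx => ?_⟩
  have hy' := hb ρ y c hy hc
  have hc0 : 0 ≤ c := by
    have := (norm_nonneg _).trans (hc L (right_mem_Icc.2 hL.le))
    simpa using this
  set τ := |ρ.im|
  set K : ℝ := (L + 1) * M * c * Real.exp (τ * (L - x)) with hK
  have hK0 : 0 ≤ K := by positivity
  -- The remainder is exactly the Volterra integral, and its kernel absorbs the factor `1 + ‖ρ‖`.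
  rw [hy.volterra hL hx, sub_sub_cancel_left, norm_neg]
  have hq1 := (intervalIntegrable_norm_of_memLp hq hx).1
  have e1 : (1 + ‖ρ‖) * ‖∫ t in x..L, q t * (y t * sinOver ρ (x - t))‖
      = ‖∫ t in x..L, ((1 + ‖ρ‖ : ℝ) : ℂ) * (q t * (y t * sinOver ρ (x - t)))‖ := by
    rw [intervalIntegral.integral_const_mul, norm_mul, Complex.norm_real,
      Real.norm_of_nonneg (by positivity)]
  rw [e1]
  refine (norm_integral_volterra_le hx (hq1.const_mul K) fun t ht => ?_).trans ?_
  · have ht' : t ∈ Icc 0 L := ⟨hx.1.trans ht.1, ht.2⟩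
    have ha : |x - t| = t - x := by rw [abs_of_nonpos (by linarith [ht.1])]; ring
    have h1 : (1 + ‖ρ‖) * ‖sinOver ρ (x - t)‖ ≤ (L + 1) * Real.exp (τ * (t - x)) := by
      have := one_add_norm_mul_norm_sinOver_le (ρ := ρ) (u := x - t) (L := L)
        (by rw [ha]; linarith [ht.2, hx.1])
      rwa [ha] at this
    calc ‖((1 + ‖ρ‖ : ℝ) : ℂ) * (q t * (y t * sinOver ρ (x - t)))‖
        = ‖q t‖ * (‖y t‖ * ((1 + ‖ρ‖) * ‖sinOver ρ (x - t)‖)) := by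
          rw [norm_mul, Complex.norm_real, Real.norm_of_nonneg (by positivity), norm_mul, norm_mul]
          ring
      _ ≤ ‖q t‖ * (M * c * Real.exp (τ * (L - t)) * ((L + 1) * Real.exp (τ * (t - x)))) := by
          gcongr
          exact hy' t ht'
      _ = (L + 1) * M * c * (Real.exp (τ * (L - t)) * Real.exp (τ * (t - x))) * ‖q t‖ := by ring
      _ = K * ‖q t‖ := by rw [hK, ← Real.exp_add]; ring_nf
  · rw [intervalIntegral.integral_const_mul]
    have hmono : ∫ t in x..L, ‖q t‖ ≤ Q :=
      intervalIntegral.integral_mono_interval hx.1 hx.2 le_rfl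
        (Eventually.of_forall fun t => norm_nonneg _)
        (intervalIntegrable_norm_of_memLp hq (left_mem_Icc.2 hL.le)).1
    calc K * ∫ t in x..L, ‖q t‖ ≤ K * (Q + 1) := by gcongr; linarith
      _ = _ := by rw [hK]; ring

lemma norm_cos_mul_sub_le (ρ : ℂ) {x L : ℝ} (hx : x ≤ L) :
    ‖Complex.cos (ρ * (x - L))‖ ≤ Real.exp (|ρ.im| * (L - x)) := by
  refine (norm_cos_le_exp _).trans (le_of_eq ?_)
  have : (ρ * ((x : ℂ) - L)).im = ρ.im * (x - L) := by simp [Complex.mul_im]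
  rw [this, abs_mul, abs_of_nonpos (sub_nonpos.2 hx), neg_sub]

/-- Bound for the solution of the unperturbed equation with data `α, β` at `L`. -/
lemma norm_unperturbed_le (α β ρ : ℂ) {x : ℝ} (hx : x ∈ Icc 0 L) :
    ‖α * Complex.cos (ρ * (x - L)) + β * sinOver ρ (x - L)‖
      ≤ (‖α‖ + ‖β‖ * L) * Real.exp (|ρ.im| * (L - x)) := by
  have ha : |x - L| = L - x := by rw [abs_of_nonpos (by linarith [hx.2])]; ring
  have h1 := norm_cos_mul_sub_le ρ hx.2
  have h2 : ‖sinOver ρ (x - L)‖ ≤ L * Real.exp (|ρ.im| * (L - x)) := by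
    have := norm_sinOver_le ρ (x - L)
    rw [ha] at this
    refine this.trans (mul_le_mul_of_nonneg_right (by linarith [hx.1]) (Real.exp_pos _).le)
  refine (norm_add_le _ _).trans ?_
  rw [norm_mul, norm_mul, add_mul, mul_assoc ‖β‖]
  gcongr

/-- The unperturbed solution is the cosine plus `-H` times `sinOver`; the second piece already has
the size of the error and is moved into it. -/
lemma exists_psi_bound (hL : 0 < L) (hq : MemLp q 2 (volume.restrict (Icc 0 L))) {H : ℂ}
    {ψ : ℂ → ℝ → ℂ} (hψ : IsSolutionPsi q L H ψ) {x : ℝ} (hx : x ∈ Icc 0 L) :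
    ∃ C : ℝ, 0 < C ∧ ∀ ρ : ℂ, ‖ψ ρ x - Complex.cos (ρ * (x - L))‖
      ≤ C * Real.exp (|ρ.im| * (L - x)) / (1 + ‖ρ‖) := by
  obtain ⟨M, hM, hb⟩ := exists_remainder_bound hL hq
  refine ⟨M * (1 + ‖H‖ * L) + ‖H‖ * (L + 1), by positivity, fun ρ => ?_⟩
  obtain ⟨hs, h0, h1⟩ := hψ ρ
  have h2 := hb ρ (ψ ρ) (1 + ‖H‖ * L) hs (fun t ht => by
    have := norm_unperturbed_le 1 (-H) ρ ht
    rw [norm_one, norm_neg H] at this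
    rwa [h0, h1]) x hx
  rw [h0, h1, one_mul] at h2
  have ha : |x - L| = L - x := by rw [abs_of_nonpos (by linarith [hx.2])]; ring
  have h3 := one_add_norm_mul_norm_sinOver_le (ρ := ρ) (u := x - L) (L := L)
    (by rw [ha]; linarith [hx.1])
  rw [ha] at h3
  have h4 := mul_le_mul_of_nonneg_left h3 (norm_nonneg H)
  rw [le_div_iff₀ (by positivity)]
  have h5 : ‖ψ ρ x - Complex.cos (ρ * (x - L))‖
      ≤ ‖ψ ρ x - (Complex.cos (ρ * (x - L)) + -H * sinOver ρ (x - L))‖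
        + ‖H‖ * ‖sinOver ρ (x - L)‖ := by
    rw [← norm_mul, ← norm_neg (H * _)]
    refine le_trans (le_of_eq ?_) (norm_add_le _ _)
    congr 1; ring
  have h6 := mul_le_mul_of_nonneg_right h5 (show (0 : ℝ) ≤ 1 + ‖ρ‖ by positivity)
  linarith

lemma exists_T_bound (hL : 0 < L) (hq : MemLp q 2 (volume.restrict (Icc 0 L)))
    {T : ℂ → ℝ → ℂ} (hT : IsSolutionT q L T) {x : ℝ} (hx : x ∈ Icc 0 L) :
    ∃ C : ℝ, 0 < C ∧ ∀ ρ : ℂ, ‖ρ * T ρ x - Complex.sin (ρ * (x - L))‖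
      ≤ C * Real.exp (|ρ.im| * (L - x)) / (1 + ‖ρ‖) := by
  obtain ⟨M, hM, hb⟩ := exists_remainder_bound hL hq
  refine ⟨M * (L + 1), by positivity, fun ρ => ?_⟩
  obtain ⟨hs, h0, h1⟩ := hT ρ
  -- The constant `c` may depend on `ρ`. Here the unperturbed solution itself decays like `1 / (1 +
  -- ‖ρ‖)`, so the remainder gains a second such factor, one of which survives multiplication by
  -- `ρ`.
  have h2 := hb ρ (T ρ) ((L + 1) / (1 + ‖ρ‖)) hs (fun t ht => by
    have ha : |t - L| = L - t := by rw [abs_of_nonpos (by linarith [ht.2])]; ring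
    have := one_add_norm_mul_norm_sinOver_le (ρ := ρ) (u := t - L) (L := L)
      (by rw [ha]; linarith [ht.1])
    rw [ha] at this
    rw [h0, h1, zero_mul, zero_add, one_mul, div_mul_eq_mul_div, le_div_iff₀ (by positivity)]
    linarith) x hx
  rw [h0, h1, zero_mul, zero_add, one_mul] at h2
  have e : ρ * T ρ x - Complex.sin (ρ * (x - L)) = ρ * (T ρ x - sinOver ρ (x - L)) := by
    rw [mul_sub ρ (T ρ x), mul_sinOver, Complex.ofReal_sub]
  rw [e, norm_mul]
  have h3 : ‖ρ‖ * ‖T ρ x - sinOver ρ (x - L)‖ ≤ (1 + ‖ρ‖) * ‖T ρ x - sinOver ρ (x - L)‖ := by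
    gcongr; linarith
  refine (h3.trans h2).trans (le_of_eq ?_)
  ring

end Estimates

/-! ### Evenness and analyticity in the spectral parameter. -/

section Analyticity

variable {q : ℝ → ℂ} {L : ℝ} {H α β : ℂ} {T ψ y : ℂ → ℝ → ℂ}

lemma wronskian_T_psi (hL : 0 < L) (hT : IsSolutionT q L T) (hψ : IsSolutionPsi q L H ψ)
    (ρ : ℂ) {x : ℝ} (hx : x ∈ Icc 0 L) :
    derivWithin (T ρ) (Icc 0 L) x * ψ ρ x - T ρ x * derivWithin (ψ ρ) (Icc 0 L) x = 1 := by
  have h := ((hT ρ).1.lagrange hL (hψ ρ).1 hx).2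
  rw [(hT ρ).2.1, (hT ρ).2.2, (hψ ρ).2.1, (hψ ρ).2.2] at h
  simp only [sub_self, zero_mul, intervalIntegral.integral_zero] at h
  linear_combination -h

/-- A solution at the parameter `μ` in terms of the fundamental system at the parameter `ρ`. -/
lemma solution_eq_of_fundamental_system (hL : 0 < L) (hT : IsSolutionT q L T)
    (hψ : IsSolutionPsi q L H ψ)
    (hy : ∀ ρ, IsSolution q L ρ (y ρ) ∧ y ρ L = α ∧ derivWithin (y ρ) (Icc 0 L) L = β)
    (ρ μ : ℂ) {x : ℝ} (hx : x ∈ Icc 0 L) :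
    y μ x = ψ ρ x * α + T ρ x * (α * H + β)
      + (μ ^ 2 - ρ ^ 2) * ∫ t in x..L, y μ t * (T ρ x * ψ ρ t - ψ ρ x * T ρ t) := by
  obtain ⟨hs, h0, h1⟩ := hy μ
  have hsub : Icc x L ⊆ Icc 0 L := Icc_subset_Icc_left hx.1
  have hint : ∀ w : ℝ → ℂ, ContinuousOn w (Icc 0 L) →
      IntervalIntegrable (fun t => y μ t * w t) volume x L := fun w hw =>
    ContinuousOn.intervalIntegrable (by
      rw [uIcc_of_le hx.2]; exact (hs.continuousOn.mul hw).mono hsub)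
  have key : ∀ w : ℝ → ℂ, ∫ t in x..L, ((q t - ρ ^ 2) - (q t - μ ^ 2)) * (y μ t * w t)
      = (μ ^ 2 - ρ ^ 2) * ∫ t in x..L, y μ t * w t := by
    intro w
    rw [← intervalIntegral.integral_const_mul]
    congr 1; ext t; ring
  have hl1 := (hs.lagrange hL (hT ρ).1 hx).2
  have hl2 := (hs.lagrange hL (hψ ρ).1 hx).2
  rw [key, h0, h1, (hT ρ).2.1, (hT ρ).2.2] at hl1
  rw [key, h0, h1, (hψ ρ).2.1, (hψ ρ).2.2] at hl2
  have hW := wronskian_T_psi hL hT hψ ρ hx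
  have hsplit : ∫ t in x..L, y μ t * (T ρ x * ψ ρ t - ψ ρ x * T ρ t)
      = T ρ x * (∫ t in x..L, y μ t * ψ ρ t) - ψ ρ x * ∫ t in x..L, y μ t * T ρ t := by
    rw [← intervalIntegral.integral_const_mul, ← intervalIntegral.integral_const_mul,
      ← intervalIntegral.integral_sub ((hint _ (hψ ρ).1.continuousOn).const_mul _)
        ((hint _ (hT ρ).1.continuousOn).const_mul _)]
    congr 1; ext t; ring
  rw [hsplit]
  linear_combination (-y μ x) * hW + ψ ρ x * hl1 - T ρ x * hl2

/-- Solutions with fixed data at `L` depend only on the square of the parameter. -/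
lemma solution_neg (hL : 0 < L) (hT : IsSolutionT q L T) (hψ : IsSolutionPsi q L H ψ)
    (hy : ∀ ρ, IsSolution q L ρ (y ρ) ∧ y ρ L = α ∧ derivWithin (y ρ) (Icc 0 L) L = β)
    (ρ : ℂ) {x : ℝ} (hx : x ∈ Icc 0 L) : y (-ρ) x = y ρ x := by
  rw [solution_eq_of_fundamental_system hL hT hψ hy ρ (-ρ) hx,
    solution_eq_of_fundamental_system hL hT hψ hy ρ ρ hx]
  simp

/-- Only continuity of `J` is needed, because the slope of the product at a zero of `u` is the slope
of `u` times `J`. It is used with `u μ = μ ^ 2 - ρ ^ 2`. -/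
lemma hasDerivAt_mul_of_eq_zero {u J : ℂ → ℂ} {u' ρ : ℂ} (hu : HasDerivAt u u' ρ)
    (h0 : u ρ = 0) (hJ : ContinuousAt J ρ) :
    HasDerivAt (fun z => u z * J z) (u' * J ρ) ρ := by
  rw [hasDerivAt_iff_tendsto_slope] at hu ⊢
  have h := hu.mul (hJ.tendsto.mono_left nhdsWithin_le_nhds)
  refine h.congr fun z => ?_
  simp [slope_def_field, h0]
  ring

/-- A bootstrap through one representation: local boundedness gives continuity at `ρ`, dominated
convergence then gives continuity of the integral, and the vanishing factor turns that into
differentiability. -/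
lemma differentiable_solution (hL : 0 < L) (hq : MemLp q 2 (volume.restrict (Icc 0 L)))
    (hT : IsSolutionT q L T) (hψ : IsSolutionPsi q L H ψ)
    (hy : ∀ ρ, IsSolution q L ρ (y ρ) ∧ y ρ L = α ∧ derivWithin (y ρ) (Icc 0 L) L = β)
    {x : ℝ} (hx : x ∈ Icc 0 L) : Differentiable ℂ (fun ρ => y ρ x) := by
  intro ρ
  obtain ⟨M, hM, hb⟩ := exists_solution_bound hL hq
  obtain ⟨B, hB0, hB⟩ : ∃ B : ℝ, 0 ≤ B ∧ ∀ μ ∈ Metric.ball ρ 1, ∀ t ∈ Icc 0 L, ‖y μ t‖ ≤ B := by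
    refine ⟨M * (‖α‖ + ‖β‖ * L) * Real.exp ((‖ρ‖ + 1) * L), by positivity, fun μ hμ t ht => ?_⟩
    obtain ⟨hs, h0, h1⟩ := hy μ
    have h2 := hb μ (y μ) (‖α‖ + ‖β‖ * L) hs
      (fun t ht => by rw [h0, h1]; exact norm_unperturbed_le α β μ ht) t ht
    refine h2.trans ?_
    have h3 : |μ.im| ≤ ‖ρ‖ + 1 := by
      have := norm_sub_norm_le μ ρ
      rw [← dist_eq_norm] at this
      linarith [Complex.abs_im_le_norm μ, Metric.mem_ball.1 hμ]
    gcongr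
    · linarith [ht.2]
    · linarith [ht.1]
  have hball : ∀ᶠ μ in 𝓝 ρ, μ ∈ Metric.ball ρ 1 := Metric.ball_mem_nhds ρ one_pos
  have hmeas : ∀ μ (t : ℝ), t ∈ Icc 0 L → IntervalIntegrable
      (fun s => y μ s * (T ρ t * ψ ρ s - ψ ρ t * T ρ s)) volume t L := by
    intro μ t ht
    refine ContinuousOn.intervalIntegrable ?_
    rw [uIcc_of_le ht.2]
    exact ((hy μ).1.continuousOn.mul ((continuousOn_const.mul (hψ ρ).1.continuousOn).sub
      (continuousOn_const.mul (hT ρ).1.continuousOn))).mono (Icc_subset_Icc_left ht.1)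
  have hkernel : ∀ t ∈ Icc 0 L, ∃ D : ℝ, 0 ≤ D ∧ ∀ s ∈ Icc 0 L,
      ‖T ρ t * ψ ρ s - ψ ρ t * T ρ s‖ ≤ D := by
    intro t _
    obtain ⟨D, hD⟩ := isCompact_Icc.exists_bound_of_continuousOn
      ((continuousOn_const (c := T ρ t).mul (hψ ρ).1.continuousOn).sub
      (continuousOn_const (c := ψ ρ t).mul (hT ρ).1.continuousOn))
    exact ⟨D, (norm_nonneg _).trans (hD 0 (left_mem_Icc.2 hL.le)), hD⟩
  have hu : HasDerivAt (fun μ : ℂ => μ ^ 2 - ρ ^ 2) (2 * ρ) ρ := by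
    simpa using ((hasDerivAt_id ρ).pow 2).sub_const (ρ ^ 2)
  have hcont : ∀ t ∈ Icc 0 L, ContinuousAt (fun μ => y μ t) ρ := by
    intro t ht
    obtain ⟨D, hD0, hD⟩ := hkernel t ht
    have hz : Tendsto (fun μ : ℂ => ‖μ ^ 2 - ρ ^ 2‖ * (B * D * |L - t|)) (𝓝 ρ) (𝓝 0) := by
      have := (hu.continuousAt.norm.tendsto).mul_const (B * D * |L - t|)
      simpa using this
    have h2 : Tendsto (fun μ : ℂ => (μ ^ 2 - ρ ^ 2) *
        ∫ s in t..L, y μ s * (T ρ t * ψ ρ s - ψ ρ t * T ρ s)) (𝓝 ρ) (𝓝 0) := by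
      refine squeeze_zero_norm' ?_ hz
      filter_upwards [hball] with μ hμ
      rw [norm_mul]
      refine mul_le_mul_of_nonneg_left ?_ (norm_nonneg _)
      refine intervalIntegral.norm_integral_le_of_norm_le_const fun s hs => ?_
      rw [uIoc_of_le ht.2] at hs
      have hs' : s ∈ Icc 0 L := ⟨ht.1.trans hs.1.le, hs.2⟩
      rw [norm_mul]
      exact mul_le_mul (hB μ hμ s hs') (hD s hs') (norm_nonneg _) hB0
    have h3 : (fun μ => y μ t) = fun μ => (ψ ρ t * α + T ρ t * (α * H + β)) + (μ ^ 2 - ρ ^ 2) *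
        ∫ s in t..L, y μ s * (T ρ t * ψ ρ s - ψ ρ t * T ρ s) :=
      funext fun μ => solution_eq_of_fundamental_system hL hT hψ hy ρ μ ht
    have h4 := tendsto_const_nhds (x := ψ ρ t * α + T ρ t * (α * H + β)).add h2
    rw [ContinuousAt, solution_eq_of_fundamental_system hL hT hψ hy ρ ρ ht, h3]
    simpa using h4
  obtain ⟨D, hD0, hD⟩ := hkernel x hx
  have hJ : ContinuousAt (fun μ =>
      ∫ s in x..L, y μ s * (T ρ x * ψ ρ s - ψ ρ x * T ρ s)) ρ := by
    refine intervalIntegral.continuousAt_of_dominated_interval (bound := fun _ => B * D)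
      (Eventually.of_forall fun μ => ?_) ?_ (by simp) ?_
    · exact (intervalIntegrable_iff.1 (hmeas μ x hx)).aestronglyMeasurable
    · filter_upwards [hball] with μ hμ
      refine Eventually.of_forall fun s hs => ?_
      rw [uIoc_of_le hx.2] at hs
      have hs' : s ∈ Icc 0 L := ⟨hx.1.trans hs.1.le, hs.2⟩
      rw [norm_mul]
      exact mul_le_mul (hB μ hμ s hs') (hD s hs') (norm_nonneg _) hB0
    · refine Eventually.of_forall fun s hs => ?_
      rw [uIoc_of_le hx.2] at hs
      exact (hcont s ⟨hx.1.trans hs.1.le, hs.2⟩).mul continuousAt_const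
  have h3 : (fun μ => y μ x) = fun μ => (ψ ρ x * α + T ρ x * (α * H + β)) + (μ ^ 2 - ρ ^ 2) *
      ∫ s in x..L, y μ s * (T ρ x * ψ ρ s - ψ ρ x * T ρ s) :=
    funext fun μ => solution_eq_of_fundamental_system hL hT hψ hy ρ μ hx
  rw [h3]
  exact ((hasDerivAt_mul_of_eq_zero hu (by simp) hJ).const_add _).differentiableAt

end Analyticity

/-! ### The complex cardinal sine. -/

section Sinc

lemma sinc_eq_sinOver (z : ℂ) : sinc z = sinOver (Real.pi * z) 1 := by
  have hpi : (Real.pi : ℂ) ≠ 0 := Complex.ofReal_ne_zero.2 Real.pi_ne_zero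
  by_cases h : z = 0 <;> simp [sinc, sinOver, h, hpi]

lemma pi_mul_mul_sinc (z : ℂ) : Real.pi * z * sinc z = Complex.sin (Real.pi * z) := by
  rw [sinc_eq_sinOver, mul_sinOver, Complex.ofReal_one, mul_one]

lemma norm_sinc_le (z : ℂ) : ‖sinc z‖ ≤ 2 * Real.exp (Real.pi * |z.im|) / (1 + ‖z‖) := by
  rw [le_div_iff₀ (by positivity), sinc_eq_sinOver]
  have h := one_add_norm_mul_norm_sinOver_le (ρ := Real.pi * z) (u := 1) (L := 1) (by simp)
  have h1 : (Real.pi * z).im = Real.pi * z.im := by simp [Complex.mul_im]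
  rw [h1, abs_mul, abs_of_pos Real.pi_pos, abs_one, mul_one] at h
  have h2 : ‖z‖ ≤ ‖Real.pi * z‖ := by
    rw [norm_mul, Complex.norm_real, Real.norm_of_nonneg Real.pi_pos.le]
    nlinarith [Real.pi_gt_three, norm_nonneg z]
  have h3 := mul_le_mul_of_nonneg_right h2 (norm_nonneg (sinOver (Real.pi * z) 1))
  linarith

lemma differentiable_sinc : Differentiable ℂ sinc := by
  have hpi : (Real.pi : ℂ) ≠ 0 := Complex.ofReal_ne_zero.2 Real.pi_ne_zero
  have h1 : Differentiable ℂ (dslope Complex.sin 0) := by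
    rw [← differentiableOn_univ]
    exact (Complex.differentiableOn_dslope univ_mem).2 Complex.differentiable_sin.differentiableOn
  have h2 : sinc = fun z => dslope Complex.sin 0 (Real.pi * z) := by
    ext z
    by_cases h : z = 0
    · simp [sinc, h]
    · rw [dslope_of_ne _ (mul_ne_zero hpi h)]
      simp [sinc, h, slope_def_field]
  rw [h2]
  exact h1.comp (differentiable_id.const_mul _)

lemma sinc_zero : sinc 0 = 1 := by simp [sinc]

lemma sinc_intCast {k : ℤ} (hk : k ≠ 0) : sinc k = 0 := by
  rw [sinc, if_neg (Int.cast_ne_zero.2 hk), mul_comm, Complex.sin_int_mul_pi, zero_div]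

lemma sinc_neg (z : ℂ) : sinc (-z) = sinc z := by
  by_cases h : z = 0 <;> simp [sinc, h]

end Sinc

/-! ### Tails and convergence of cardinal series. -/

section Majorant

lemma summable_int_one_add_abs_rpow :
    Summable (fun j : ℤ => (1 + |(j : ℝ)|) ^ (-(9 / 8) : ℝ)) := by
  have h : Summable (fun n : ℕ => (1 + (n : ℝ)) ^ (-(9 / 8) : ℝ)) := by
    have h1 : Summable (fun n : ℕ => (n : ℝ) ^ (-(9 / 8) : ℝ)) :=
      Real.summable_nat_rpow.2 (by norm_num)
    have h2 := (summable_nat_add_iff 1).2 h1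
    refine h2.congr fun n => ?_
    push_cast; rw [add_comm]
  refine Summable.of_nat_of_neg ?_ ?_ <;> simpa using h

/-- Replacing `w` by its floor costs a factor `2 ^ (9 / 8)` and turns the second part into a sum
over distinct integers, so the full sum over `ℤ` bounds it whatever `w` and `ν` are. -/
lemma exists_majorant_sum_bound : ∃ B : ℝ, 0 < B ∧ ∀ (w : ℝ) (ν : ℕ → ℕ), ν.Injective →
    Summable (fun n => ((ν n : ℝ) + 1) ^ (-(9 / 8) : ℝ)
      + (1 + |w - ν n|) ^ (-(9 / 8) : ℝ)) ∧
    ∑' n, (((ν n : ℝ) + 1) ^ (-(9 / 8) : ℝ) + (1 + |w - ν n|) ^ (-(9 / 8) : ℝ)) ≤ B := by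
  set f : ℤ → ℝ := fun j => (1 + |(j : ℝ)|) ^ (-(9 / 8) : ℝ) with hf
  have hs : Summable f := summable_int_one_add_abs_rpow
  have hf0 : ∀ j, 0 ≤ f j := fun j => by positivity
  set S := ∑' j, f j
  have hS : 0 ≤ S := tsum_nonneg hf0
  refine ⟨S + 2 ^ (9 / 8 : ℝ) * S + 1, by positivity, fun w ν hν => ?_⟩
  have hi1 : Function.Injective (fun n => (ν n : ℤ)) := fun a b h => hν (Int.ofNat_inj.1 h)
  have hi2 : Function.Injective (fun n => ⌊w⌋ - (ν n : ℤ)) :=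
    fun a b h => hν (by simpa using h)
  have e1 : ∀ n, ((ν n : ℝ) + 1) ^ (-(9 / 8) : ℝ) = f (ν n) := by
    intro n
    simp [hf, add_comm]
  have e2 : ∀ n, (1 + |w - ν n|) ^ (-(9 / 8) : ℝ) ≤ 2 ^ (9 / 8 : ℝ) * f (⌊w⌋ - (ν n : ℤ)) := by
    intro n
    simp only [hf]
    push_cast
    set a : ℝ := |(⌊w⌋ : ℝ) - ν n|
    have ha : 0 ≤ a := abs_nonneg _
    have h1 : a ≤ |w - ν n| + 1 := by
      have h2 : (⌊w⌋ : ℝ) - ν n = (w - ν n) + -(w - ⌊w⌋) := by ring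
      have h3 : |(-(w - ⌊w⌋) : ℝ)| ≤ 1 := by
        rw [abs_neg, abs_of_nonneg (by linarith [Int.floor_le w])]
        linarith [Int.lt_floor_add_one w]
      calc a = |(w - ν n) + -(w - ⌊w⌋)| := by rw [← h2]
        _ ≤ _ := (abs_add_le _ _).trans (by linarith)
    have h4 : (1 + a) / 2 ≤ 1 + |w - ν n| := by
      linarith [abs_nonneg (w - ν n)]
    calc (1 + |w - ν n|) ^ (-(9 / 8) : ℝ) ≤ ((1 + a) / 2) ^ (-(9 / 8) : ℝ) :=
          Real.rpow_le_rpow_of_nonpos (by positivity) h4 (by norm_num)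
      _ = 2 ^ (9 / 8 : ℝ) * (1 + a) ^ (-(9 / 8) : ℝ) := by
          rw [Real.div_rpow (by positivity) (by norm_num), Real.rpow_neg (by norm_num : (0:ℝ) ≤ 2)]
          field_simp
  have s1 : Summable (fun n => f (ν n)) := hs.comp_injective hi1
  have s2 : Summable (fun n => 2 ^ (9 / 8 : ℝ) * f (⌊w⌋ - (ν n : ℤ))) :=
    (hs.comp_injective hi2).mul_left _
  have s3 : Summable (fun n => (1 + |w - ν n|) ^ (-(9 / 8) : ℝ)) :=
    Summable.of_nonneg_of_le (fun n => by positivity) e2 s2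
  have s4 : Summable (fun n => ((ν n : ℝ) + 1) ^ (-(9 / 8) : ℝ)) := by simpa only [e1] using s1
  refine ⟨s4.add s3, ?_⟩
  rw [s4.tsum_add s3]
  have t1 : ∑' n, ((ν n : ℝ) + 1) ^ (-(9 / 8) : ℝ) ≤ S := by
    simp only [e1]
    exact _root_.tsum_comp_le_tsum_of_inj hs hf0 hi1
  have t2 : ∑' n, (1 + |w - ν n|) ^ (-(9 / 8) : ℝ) ≤ 2 ^ (9 / 8 : ℝ) * S := by
    refine (s3.tsum_le_tsum e2 s2).trans ?_
    rw [tsum_mul_left]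
    exact mul_le_mul_of_nonneg_left (_root_.tsum_comp_le_tsum_of_inj hs hf0 hi2) (by positivity)
  linarith

/-- The exponents share out the available decay: `1 / 8` makes tails tend to zero, `5 / 8 > 1 / 2`
is square integrable in `R`, and `9 / 8 > 1` is summable. The larger of `a`, `b` is at least `R / 2`
and supplies the power of `R`. -/
lemma one_div_mul_le {a b R : ℝ} (ha : 1 ≤ a) (hb : 1 ≤ b) (hR : 0 < R) (h : R ≤ a + b) :
    1 / (a * b) ≤ a ^ (-(1 / 8) : ℝ) * (2 * R ^ (-(5 / 8) : ℝ))
      * (a ^ (-(9 / 8) : ℝ) + b ^ (-(9 / 8) : ℝ)) := by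
  have key : ∀ c d : ℝ, 1 ≤ c → c ≤ d → R ≤ c + d →
      c ^ (-(7 / 8) : ℝ) * d ^ (-(7 / 8) : ℝ) ≤ 2 * R ^ (-(5 / 8) : ℝ) * c ^ (-(9 / 8) : ℝ) := by
    intro c d hc hcd hR'
    have hc0 : 0 < c := by linarith
    have hd0 : 0 < d := by linarith
    have e : d ^ (-(7 / 8) : ℝ) = d ^ (-(1 / 4) : ℝ) * d ^ (-(5 / 8) : ℝ) := by
      rw [← Real.rpow_add hd0]; norm_num
    have h1 : d ^ (-(1 / 4) : ℝ) ≤ c ^ (-(1 / 4) : ℝ) :=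
      Real.rpow_le_rpow_of_nonpos hc0 hcd (by norm_num)
    have h2 : d ^ (-(5 / 8) : ℝ) ≤ 2 * R ^ (-(5 / 8) : ℝ) := by
      calc d ^ (-(5 / 8) : ℝ) ≤ (R / 2) ^ (-(5 / 8) : ℝ) :=
            Real.rpow_le_rpow_of_nonpos (by positivity) (by linarith) (by norm_num)
        _ = 2 ^ (5 / 8 : ℝ) * R ^ (-(5 / 8) : ℝ) := by
            rw [Real.div_rpow hR.le (by norm_num), Real.rpow_neg (by norm_num : (0:ℝ) ≤ 2)]
            field_simp
        _ ≤ 2 ^ (1 : ℝ) * R ^ (-(5 / 8) : ℝ) := by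
            gcongr
            · norm_num
            · norm_num
        _ = 2 * R ^ (-(5 / 8) : ℝ) := by rw [Real.rpow_one]
    calc c ^ (-(7 / 8) : ℝ) * d ^ (-(7 / 8) : ℝ)
        = c ^ (-(7 / 8) : ℝ) * (d ^ (-(1 / 4) : ℝ) * d ^ (-(5 / 8) : ℝ)) := by rw [e]
      _ ≤ c ^ (-(7 / 8) : ℝ) * (c ^ (-(1 / 4) : ℝ) * (2 * R ^ (-(5 / 8) : ℝ))) := by gcongr
      _ = 2 * R ^ (-(5 / 8) : ℝ) * (c ^ (-(7 / 8) : ℝ) * c ^ (-(1 / 4) : ℝ)) := by ring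
      _ = 2 * R ^ (-(5 / 8) : ℝ) * c ^ (-(9 / 8) : ℝ) := by
          rw [← Real.rpow_add hc0]; norm_num
  have ha0 : 0 < a := by linarith
  have hb0 : 0 < b := by linarith
  have h1 : 1 / (a * b) ≤ a ^ (-(1 / 8) : ℝ) * (a ^ (-(7 / 8) : ℝ) * b ^ (-(7 / 8) : ℝ)) := by
    rw [← mul_assoc, ← Real.rpow_add ha0, one_div, mul_inv, ← Real.rpow_neg_one a,
      ← Real.rpow_neg_one b]
    have h2 : b ^ (-1 : ℝ) ≤ b ^ (-(7 / 8) : ℝ) :=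
      Real.rpow_le_rpow_of_exponent_le hb (by norm_num)
    rw [show (-(1 / 8) + -(7 / 8) : ℝ) = -1 by norm_num]
    exact mul_le_mul_of_nonneg_left h2 (by positivity)
  refine h1.trans ?_
  rw [mul_assoc]
  refine mul_le_mul_of_nonneg_left ?_ (by positivity)
  have hA : 0 ≤ 2 * R ^ (-(5 / 8) : ℝ) * a ^ (-(9 / 8) : ℝ) := by positivity
  have hB : 0 ≤ 2 * R ^ (-(5 / 8) : ℝ) * b ^ (-(9 / 8) : ℝ) := by positivity
  rcases le_total a b with hab | hab
  · have := key a b ha hab h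
    linarith
  · have := key b a hb hab (by linarith)
    linarith

variable {u : ℕ → ℂ → ℂ} {ν : ℕ → ℕ} {A C β : ℝ}

/-- The tails of a series whose terms have the size of those of a cardinal series with coefficients
of order `1 / n`. -/
lemma exists_tail_bound (hν : ν.Injective) (hle : ∀ n, n ≤ ν n) (hβ : 0 < β)
    (hu : ∀ n ρ, ‖u n ρ‖ ≤ C * Real.exp (A * |ρ.im|) / ((ν n + 1) * (1 + |β * ‖ρ‖ - ν n|))) :
    ∃ D : ℝ, 0 < D ∧ ∀ ρ, Summable (fun n => ‖u n ρ‖) ∧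
      ∀ N : ℕ, ‖∑ n ∈ Finset.range N, u n ρ - ∑' n, u n ρ‖
        ≤ D * Real.exp (A * |ρ.im|) * ((N : ℝ) + 1) ^ (-(1 / 8) : ℝ)
          * (1 + β * ‖ρ‖) ^ (-(5 / 8) : ℝ) := by
  obtain ⟨B, hB, hb⟩ := exists_majorant_sum_bound
  have hC : 0 ≤ C := by
    have := (norm_nonneg _).trans (hu 0 0)
    rw [le_div_iff₀ (by positivity)] at this
    simpa using this
  refine ⟨2 * C * B + 1, by positivity, fun ρ => ?_⟩
  set w := β * ‖ρ‖ with hw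
  have hw0 : 0 ≤ w := by positivity
  have hpt : ∀ N n : ℕ, ‖u (n + N) ρ‖ ≤ C * Real.exp (A * |ρ.im|)
      * ((N : ℝ) + 1) ^ (-(1 / 8) : ℝ) * (2 * (1 + w) ^ (-(5 / 8) : ℝ))
      * (((ν (n + N) : ℝ) + 1) ^ (-(9 / 8) : ℝ) + (1 + |w - ν (n + N)|) ^ (-(9 / 8) : ℝ)) := by
    intro N n
    refine (hu (n + N) ρ).trans ?_
    set m : ℝ := (ν (n + N) : ℝ)
    -- This is where `n ≤ ν n` enters: past index `N` the factor `(m + 1) ^ (-1 / 8)` is at most `(N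
    -- + 1) ^ (-1 / 8)`.
    have hm : (N : ℝ) ≤ m := by
      have : N ≤ ν (n + N) := (Nat.le_add_left N n).trans (hle _)
      exact Nat.cast_le.2 this
    have hm0 : 0 ≤ m := by positivity
    have h1 := one_div_mul_le (a := m + 1) (b := 1 + |w - m|) (R := 1 + w) (by linarith)
      (by linarith [abs_nonneg (w - m)]) (by linarith) (by linarith [le_abs_self (w - m)])
    have h2 : (m + 1) ^ (-(1 / 8) : ℝ) ≤ ((N : ℝ) + 1) ^ (-(1 / 8) : ℝ) :=
      Real.rpow_le_rpow_of_nonpos (by positivity) (by linarith) (by norm_num)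
    rw [div_eq_mul_one_div]
    calc C * Real.exp (A * |ρ.im|) * (1 / ((m + 1) * (1 + |w - m|)))
        ≤ C * Real.exp (A * |ρ.im|) * ((m + 1) ^ (-(1 / 8) : ℝ) * (2 * (1 + w) ^ (-(5 / 8) : ℝ))
          * ((m + 1) ^ (-(9 / 8) : ℝ) + (1 + |w - m|) ^ (-(9 / 8) : ℝ))) := by gcongr
      _ ≤ C * Real.exp (A * |ρ.im|) * (((N : ℝ) + 1) ^ (-(1 / 8) : ℝ)
          * (2 * (1 + w) ^ (-(5 / 8) : ℝ))
          * ((m + 1) ^ (-(9 / 8) : ℝ) + (1 + |w - m|) ^ (-(9 / 8) : ℝ))) := by gcongr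
      _ = _ := by ring
  have hinj : ∀ N : ℕ, Function.Injective (fun n => ν (n + N)) :=
    fun N => hν.comp (add_left_injective N)
  have hsum : ∀ N : ℕ, Summable (fun n => ‖u (n + N) ρ‖) := fun N =>
    Summable.of_nonneg_of_le (fun _ => norm_nonneg _) (hpt N) ((hb w _ (hinj N)).1.mul_left _)
  refine ⟨by simpa using hsum 0, fun N => ?_⟩
  have hs : Summable (fun n => u n ρ) := Summable.of_norm (by simpa using hsum 0)
  rw [← hs.sum_add_tsum_nat_add N, sub_add_cancel_left, norm_neg]
  refine (norm_tsum_le_tsum_norm (hsum N)).trans ?_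
  refine ((hsum N).tsum_le_tsum (hpt N) ((hb w _ (hinj N)).1.mul_left _)).trans ?_
  rw [tsum_mul_left]
  calc C * Real.exp (A * |ρ.im|) * ((N : ℝ) + 1) ^ (-(1 / 8) : ℝ)
        * (2 * (1 + w) ^ (-(5 / 8) : ℝ)) * _
      ≤ C * Real.exp (A * |ρ.im|) * ((N : ℝ) + 1) ^ (-(1 / 8) : ℝ)
        * (2 * (1 + w) ^ (-(5 / 8) : ℝ)) * B :=
        mul_le_mul_of_nonneg_left (hb w _ (hinj N)).2 (by positivity)
    _ = 2 * C * B * (Real.exp (A * |ρ.im|) * ((N : ℝ) + 1) ^ (-(1 / 8) : ℝ)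
        * (1 + w) ^ (-(5 / 8) : ℝ)) := by ring
    _ ≤ (2 * C * B + 1) * (Real.exp (A * |ρ.im|) * ((N : ℝ) + 1) ^ (-(1 / 8) : ℝ)
        * (1 + w) ^ (-(5 / 8) : ℝ)) := by
        gcongr
        linarith
    _ = _ := by ring

lemma memLp_one_add_rpow (hβ : 0 < β) :
    MemLp (fun r : ℝ => (1 + β * ‖(r : ℂ)‖) ^ (-(5 / 8) : ℝ)) 2 volume := by
  have hc : Continuous (fun r : ℝ => (1 + β * ‖(r : ℂ)‖) ^ (-(5 / 8) : ℝ)) := by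
    refine Continuous.rpow_const (by fun_prop) fun r => Or.inl ?_
    positivity
  rw [memLp_two_iff_integrable_sq hc.aestronglyMeasurable]
  have h1 : Integrable (fun r : ℝ => (1 + ‖r‖) ^ (-(5 / 4) : ℝ)) volume :=
    integrable_one_add_norm (by simp; norm_num)
  refine (h1.comp_mul_left' hβ.ne').congr (Eventually.of_forall fun r => ?_)
  simp only [norm_mul, Real.norm_of_nonneg hβ.le, Complex.norm_real]
  rw [← Real.rpow_natCast, ← Real.rpow_mul (by positivity)]
  norm_num

lemma tendsto_add_one_rpow_neg (D : ℝ) :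
    Tendsto (fun N : ℕ => D * ((N : ℝ) + 1) ^ (-(1 / 8) : ℝ)) atTop (𝓝 0) := by
  have h := (tendsto_rpow_neg_atTop (show (0 : ℝ) < 1 / 8 by norm_num)).comp
    (tendsto_atTop_add_const_right _ (1 : ℝ) tendsto_natCast_atTop_atTop)
  simpa using h.const_mul D

/-- All claims follow from the tail bound: on the real line the exponential is one, leaving a null
sequence in `N` times a fixed bounded square integrable function; on compact sets the exponential is
bounded. -/
lemma convergesAsCardinalSeries_of_bound (hν : ν.Injective) (hle : ∀ n, n ≤ ν n) (hβ : 0 < β)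
    (hA : 0 ≤ A) (hc : ∀ n, Continuous (u n))
    (hu : ∀ n ρ, ‖u n ρ‖ ≤ C * Real.exp (A * |ρ.im|) / ((ν n + 1) * (1 + |β * ‖ρ‖ - ν n|))) :
    ConvergesAsCardinalSeries u (fun ρ => ∑' n, u n ρ) := by
  obtain ⟨D, hD, hb⟩ := exists_tail_bound hν hle hβ hu
  have hone : ∀ ρ : ℂ, (1 + β * ‖ρ‖) ^ (-(5 / 8) : ℝ) ≤ 1 := fun ρ =>
    Real.rpow_le_one_of_one_le_of_nonpos (by nlinarith [norm_nonneg ρ]) (by norm_num)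
  have hunif : TendstoUniformly (fun N (r : ℝ) => ∑ n ∈ Finset.range N, u n (r : ℂ))
      (fun r : ℝ => ∑' n, u n (r : ℂ)) atTop := by
    rw [Metric.tendstoUniformly_iff]
    intro ε hε
    filter_upwards [(tendsto_add_one_rpow_neg D).eventually (gt_mem_nhds hε)] with N hN r
    rw [dist_comm, dist_eq_norm]
    refine lt_of_le_of_lt ((hb r).2 N) (lt_of_le_of_lt ?_ hN)
    have h0 : 0 ≤ D * ((N : ℝ) + 1) ^ (-(1 / 8) : ℝ) := by positivity
    simpa using mul_le_mul_of_nonneg_left (hone r) h0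
  have hcS : ∀ N, Continuous (fun r : ℝ => ∑ n ∈ Finset.range N, u n (r : ℂ)) := fun N =>
    continuous_finsetSum _ fun n _ => (hc n).comp Complex.continuous_ofReal
  have hcF : Continuous (fun r : ℝ => ∑' n, u n (r : ℂ)) :=
    hunif.continuous (Frequently.of_forall hcS)
  have hh := memLp_one_add_rpow hβ
  have hbr : ∀ (N : ℕ) (r : ℝ), ‖∑ n ∈ Finset.range N, u n (r : ℂ) - ∑' n, u n (r : ℂ)‖
      ≤ D * ((N : ℝ) + 1) ^ (-(1 / 8) : ℝ) * ‖(1 + β * ‖(r : ℂ)‖) ^ (-(5 / 8) : ℝ)‖ := by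
    intro N r
    have := (hb r).2 N
    rw [Real.norm_of_nonneg (by positivity)]
    simpa using this
  have hdiff : ∀ N, MemLp (fun r : ℝ => ∑ n ∈ Finset.range N, u n (r : ℂ) - ∑' n, u n (r : ℂ))
      2 volume := fun N =>
    hh.of_le_mul ((hcS N).sub hcF).aestronglyMeasurable (Eventually.of_forall (hbr N))
  have hF : MemLp (fun r : ℝ => ∑' n, u n (r : ℂ)) 2 volume := by
    -- The zeroth partial sum is empty, so the tail bound at `N = 0` is a bound on the sum itself.
    refine (hdiff 0).neg.ae_eq (Eventually.of_forall fun r => ?_)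
    simp
  have hS : ∀ N, MemLp (fun r : ℝ => ∑ n ∈ Finset.range N, u n (r : ℂ)) 2 volume := fun N => by
    refine ((hdiff N).add hF).ae_eq (Eventually.of_forall fun r => ?_)
    simp
  refine ⟨fun K hK => ?_, fun n => ?_, hF, ?_, fun r => (hb r).1, hunif⟩
  · obtain ⟨R, hR⟩ := hK.isBounded.exists_norm_le
    rw [Metric.tendstoUniformlyOn_iff]
    intro ε hε
    filter_upwards [(tendsto_add_one_rpow_neg (D * Real.exp (A * R))).eventually
      (gt_mem_nhds hε)] with N hN ρ hρ
    rw [dist_comm, dist_eq_norm]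
    refine lt_of_le_of_lt ((hb ρ).2 N) (lt_of_le_of_lt ?_ hN)
    have h1 : |ρ.im| ≤ R := (Complex.abs_im_le_norm ρ).trans (hR ρ hρ)
    calc D * Real.exp (A * |ρ.im|) * ((N : ℝ) + 1) ^ (-(1 / 8) : ℝ)
          * (1 + β * ‖ρ‖) ^ (-(5 / 8) : ℝ)
        ≤ D * Real.exp (A * R) * ((N : ℝ) + 1) ^ (-(1 / 8) : ℝ) * 1 := by
          gcongr
          exact hone ρ
      _ = _ := mul_one _
  · have := (hS (n + 1)).sub (hS n)
    refine this.ae_eq (Eventually.of_forall fun r => ?_)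
    simp [Finset.sum_range_succ]
  · have hle : ∀ N : ℕ, eLpNorm (fun r : ℝ => ∑ n ∈ Finset.range N, u n (r : ℂ)
        - ∑' n, u n (r : ℂ)) 2 volume ≤ ENNReal.ofReal (D * ((N : ℝ) + 1) ^ (-(1 / 8) : ℝ))
        * eLpNorm (fun r : ℝ => (1 + β * ‖(r : ℂ)‖) ^ (-(5 / 8) : ℝ)) 2 volume := fun N =>
      eLpNorm_le_mul_eLpNorm_of_ae_le_mul (Eventually.of_forall (hbr N)) 2
    refine tendsto_of_tendsto_of_tendsto_of_le_of_le tendsto_const_nhds ?_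
      (fun N => zero_le) hle
    have h1 := ENNReal.tendsto_ofReal (tendsto_add_one_rpow_neg D)
    rw [ENNReal.ofReal_zero] at h1
    have := ENNReal.Tendsto.mul_const (b := eLpNorm
      (fun r : ℝ => (1 + β * ‖(r : ℂ)‖) ^ (-(5 / 8) : ℝ)) 2 volume) h1 (Or.inr hh.eLpNorm_ne_top)
    simpa using this

end Majorant

/-! ### Uniqueness for functions of exponential type. -/

section Uniqueness

/-- Division of entire functions when the denominator has simple zeros only. -/
lemma exists_entire_quotient {G S : ℂ → ℂ} (hG : Differentiable ℂ G) (hS : Differentiable ℂ S)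
    (hsimple : ∀ z, S z = 0 → deriv S z ≠ 0) (hzero : ∀ z, S z = 0 → G z = 0) :
    ∃ h : ℂ → ℂ, Differentiable ℂ h ∧ ∀ z, G z = h z * S z := by
  classical
  refine ⟨fun z => if S z = 0 then deriv G z / deriv S z else G z / S z, fun z₀ => ?_,
    fun z => ?_⟩
  · by_cases h0 : S z₀ = 0
    · have hdG : DifferentiableAt ℂ (dslope G z₀) z₀ :=
        ((Complex.differentiableOn_dslope univ_mem).2 hG.differentiableOn).differentiableAt univ_mem
      have hdS : DifferentiableAt ℂ (dslope S z₀) z₀ :=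
        ((Complex.differentiableOn_dslope univ_mem).2 hS.differentiableOn).differentiableAt univ_mem
      have hne : dslope S z₀ z₀ ≠ 0 := by rw [dslope_same]; exact hsimple z₀ h0
      -- Near a simple zero both functions lose one factor `z - z₀`, and the quotient of the
      -- `dslope`s is analytic there.
      refine (hdG.div hdS hne).congr_of_eventuallyEq ?_
      filter_upwards [hdS.continuousAt.eventually_ne hne] with z hz
      rw [Pi.div_apply]
      by_cases hzz : z = z₀
      · simp [hzz, h0]
      · have hsub : z - z₀ ≠ 0 := sub_ne_zero.2 hzz
        rw [dslope_of_ne _ hzz, slope_def_field, h0, sub_zero] at hz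
        have hSz : S z ≠ 0 := fun h => hz (by rw [h, zero_div])
        rw [if_neg hSz, dslope_of_ne _ hzz, dslope_of_ne _ hzz, slope_def_field, slope_def_field,
          h0, hzero z₀ h0, sub_zero, sub_zero]
        field_simp
    · refine ((hG z₀).div (hS z₀) h0).congr_of_eventuallyEq ?_
      filter_upwards [(hS z₀).continuousAt.eventually_ne h0] with z hz
      simp [hz]
  · by_cases h0 : S z = 0
    · simp [h0, hzero z h0]
    · simp [h0]

/-- The lines bound squares that stay away from the zeros of the sine: on the vertical ones its
modulus is a hyperbolic cosine, on the horizontal ones `π |Im w| ≥ 1` lets the growing exponential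
dominate. -/
lemma exp_le_four_mul_norm_sin {N : ℕ} {w : ℂ}
    (hw : |w.re| = N + 1 / 2 ∨ |w.im| = N + 1 / 2) :
    Real.exp (Real.pi * |w.im|) ≤ 4 * ‖Complex.sin (Real.pi * w)‖ := by
  have hre : ((Real.pi : ℂ) * w).re = Real.pi * w.re := by simp [Complex.mul_re]
  have him : ((Real.pi : ℂ) * w).im = Real.pi * w.im := by simp [Complex.mul_im]
  have hcosh : Real.exp (Real.pi * |w.im|) ≤ 2 * Real.cosh (Real.pi * w.im) := by
    rw [← Real.cosh_abs, abs_mul, abs_of_pos Real.pi_pos, Real.cosh_eq]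
    linarith [Real.exp_pos (-(Real.pi * |w.im|))]
  rcases hw with hw | hw
  · have hcos : Real.cos (Real.pi * w.re) = 0 := by
      rw [← Real.cos_abs, abs_mul, abs_of_pos Real.pi_pos, hw, Real.cos_eq_zero_iff]
      exact ⟨N, by push_cast; ring⟩
    have hsin : |Real.sin (Real.pi * w.re)| = 1 := by
      have := Real.sin_sq_add_cos_sq (Real.pi * w.re)
      rw [hcos] at this
      rw [← sq_eq_sq₀ (abs_nonneg _) zero_le_one, sq_abs]
      linarith
    have h1 : ‖Complex.sin (Real.pi * w)‖ = Real.cosh (Real.pi * w.im) := by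
      rw [Complex.sin_eq, hre, him, ← Complex.ofReal_cos, hcos, Complex.ofReal_zero, zero_mul,
        zero_mul, add_zero, norm_mul, ← Complex.ofReal_sin, ← Complex.ofReal_cosh,
        Complex.norm_real, Complex.norm_real, Real.norm_eq_abs, hsin, one_mul,
        Real.norm_of_nonneg (Real.cosh_pos _).le]
    rw [h1]
    linarith [Real.cosh_pos (Real.pi * w.im)]
  · have h1 : |Real.exp (-(Real.pi * w.im)) - Real.exp (Real.pi * w.im)|
        ≤ 2 * ‖Complex.sin (Real.pi * w)‖ := by
      have e1 : ‖Complex.exp (Real.pi * w * Complex.I)‖ = Real.exp (-(Real.pi * w.im)) := by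
        rw [Complex.norm_exp]
        congr 1
        simp
      have e2 : ‖Complex.exp (-(Real.pi * w) * Complex.I)‖ = Real.exp (Real.pi * w.im) := by
        rw [Complex.norm_exp]
        congr 1
        simp
      rw [Complex.sin, norm_div, norm_mul, Complex.norm_I, mul_one, Complex.norm_ofNat,
        mul_div_cancel₀ _ (by norm_num : (2 : ℝ) ≠ 0), ← e1, ← e2, abs_sub_comm]
      exact abs_norm_sub_norm_le _ _
    set v := Real.pi * |w.im| with hv
    have h2 : Real.exp v - Real.exp (-v)
        ≤ |Real.exp (-(Real.pi * w.im)) - Real.exp (Real.pi * w.im)| := by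
      rcases abs_cases w.im with ⟨h, _⟩ | ⟨h, _⟩
      · rw [hv, h, abs_sub_comm]; exact le_abs_self _
      · rw [hv, h, mul_neg, neg_neg]; exact le_abs_self _
    have hv1 : 1 ≤ v := by
      rw [hv, hw]
      nlinarith [Real.pi_gt_three, (Nat.cast_nonneg N : (0 : ℝ) ≤ N)]
    have h3 : Real.exp (-v) ≤ 1 / 2 := by
      have h4 : Real.exp (-v) ≤ Real.exp (-1) := Real.exp_le_exp.2 (by linarith)
      have h5 := Real.exp_neg_one_lt_d9
      linarith
    have h6 : (1 : ℝ) ≤ Real.exp v := Real.one_le_exp (by linarith)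
    linarith

/-- An entire function of exponential type `π` vanishing at the integers and decaying along the
real line vanishes identically. -/
lemma eq_zero_of_zero_at_int {G : ℂ → ℂ} (hG : Differentiable ℂ G) {C : ℝ}
    (hb : ∀ z, ‖G z‖ ≤ C * Real.exp (Real.pi * |z.im|) * (1 + ‖z‖) ^ (-(1 / 8) : ℝ))
    (h0 : ∀ k : ℤ, G k = 0) (z : ℂ) : G z = 0 := by
  have hpi : (Real.pi : ℂ) ≠ 0 := Complex.ofReal_ne_zero.2 Real.pi_ne_zero
  have hC : 0 ≤ C := by
    have := (norm_nonneg _).trans (hb 0)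
    simpa using this
  have hd : ∀ z : ℂ, HasDerivAt (fun z => Complex.sin (Real.pi * z))
      (Complex.cos (Real.pi * z) * (Real.pi * 1)) z := fun z =>
    ((hasDerivAt_id z).const_mul (Real.pi : ℂ)).csin
  obtain ⟨h, hh, hGh⟩ := exists_entire_quotient (S := fun z => Complex.sin (Real.pi * z)) hG
    (fun z => (hd z).differentiableAt)
    (fun z hz => by
      rw [(hd z).deriv, mul_one]
      refine mul_ne_zero (fun hc => ?_) hpi
      have := Complex.sin_sq_add_cos_sq (Real.pi * z)
      rw [hc, hz] at this
      simp at this)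
    (fun z hz => by
      obtain ⟨k, hk⟩ := Complex.sin_eq_zero_iff.1 hz
      have : z = k := by
        apply mul_left_cancel₀ hpi
        rw [hk, mul_comm]
      rw [this, h0])
  have hbound : ∀ N : ℕ, |z.re| ≤ N + 1 / 2 → |z.im| ≤ N + 1 / 2 →
      ‖h z‖ ≤ 4 * C * ((N : ℝ) + 1) ^ (-(1 / 8) : ℝ) := by
    intro N hr hi
    set R : ℝ := N + 1 / 2 with hR
    have hR0 : 0 < R := by positivity
    have hcl : closure (Ioo (-R) R) = Icc (-R) R := closure_Ioo (by linarith)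
    -- By the maximum principle it is enough to bound `h` on the boundary of the square, where the
    -- sine cancels the exponential growth of `G`.
    refine Complex.norm_le_of_forall_mem_frontier_norm_le (U := Ioo (-R) R ×ℂ Ioo (-R) R)
      ((Metric.isBounded_Ioo _ _).reProdIm (Metric.isBounded_Ioo _ _))
      hh.diffContOnCl (fun w hw => ?_) ?_
    · have hw' : |w.re| = N + 1 / 2 ∨ |w.im| = N + 1 / 2 := by
        rw [Complex.frontier_reProdIm, frontier_Ioo (by linarith)] at hw
        have aux : ∀ v : ℝ, v ∈ ({-R, R} : Set ℝ) → |v| = R := by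
          rintro v (rfl | rfl)
          · rw [abs_neg, abs_of_pos hR0]
          · exact abs_of_pos hR0
        rcases hw with hw | hw
        · exact Or.inr (aux _ hw.2)
        · exact Or.inl (aux _ hw.1)
      have h1 := exp_le_four_mul_norm_sin hw'
      have hN : (N : ℝ) + 1 ≤ 1 + ‖w‖ + 1 / 2 ∧ (N : ℝ) + 1 / 2 ≤ ‖w‖ := by
        rcases hw' with h | h
        · have := Complex.abs_re_le_norm w
          constructor <;> linarith
        · have := Complex.abs_im_le_norm w
          constructor <;> linarith
      have h2 : (1 + ‖w‖) ^ (-(1 / 8) : ℝ) ≤ ((N : ℝ) + 1) ^ (-(1 / 8) : ℝ) :=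
        Real.rpow_le_rpow_of_nonpos (by positivity) (by linarith [hN.2]) (by norm_num)
      have hs0 : 0 < ‖Complex.sin (Real.pi * w)‖ := by
        have := Real.exp_pos (Real.pi * |w.im|)
        linarith
      refine le_of_mul_le_mul_right ?_ hs0
      calc ‖h w‖ * ‖Complex.sin (Real.pi * w)‖ = ‖G w‖ := by rw [hGh w, norm_mul]
        _ ≤ C * Real.exp (Real.pi * |w.im|) * (1 + ‖w‖) ^ (-(1 / 8) : ℝ) := hb w
        _ ≤ C * (4 * ‖Complex.sin (Real.pi * w)‖) * ((N : ℝ) + 1) ^ (-(1 / 8) : ℝ) := by gcongr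
        _ = _ := by ring
    · rw [Complex.closure_reProdIm, hcl]
      exact ⟨abs_le.1 hr, abs_le.1 hi⟩
  have hlim : ‖h z‖ ≤ 0 := by
    refine ge_of_tendsto (tendsto_add_one_rpow_neg (4 * C)) ?_
    filter_upwards [eventually_ge_atTop ⌈‖z‖⌉₊] with N hN
    have h1 : ‖z‖ ≤ N := (Nat.le_ceil _).trans (by exact_mod_cast hN)
    exact hbound N (by linarith [Complex.abs_re_le_norm z]) (by linarith [Complex.abs_im_le_norm z])
  rw [hGh z, norm_le_zero_iff.1 hlim, zero_mul]

end Uniqueness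

/-! ### The sampling theorem. -/

section Sampling

lemma norm_sinc_sub_add_sinc_add_le (z : ℂ) (m : ℕ) :
    ‖sinc (z - m) + sinc (z + m)‖
      ≤ 4 * Real.exp (Real.pi * |z.im|) / (1 + |‖z‖ - m|) := by
  have h1 : |‖z‖ - m| ≤ ‖z - m‖ := by
    have := abs_norm_sub_norm_le z (m : ℂ)
    rwa [Complex.norm_natCast] at this
  have h2 : |‖z‖ - m| ≤ ‖z + m‖ := by
    have := abs_norm_sub_norm_le z (-(m : ℂ))
    rwa [norm_neg, Complex.norm_natCast, sub_neg_eq_add] at this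
  have i1 := norm_sinc_le (z - m)
  have i2 := norm_sinc_le (z + m)
  rw [show (z - m).im = z.im by simp] at i1
  rw [show (z + m).im = z.im by simp] at i2
  have j1 : 2 * Real.exp (Real.pi * |z.im|) / (1 + ‖z - m‖)
      ≤ 2 * Real.exp (Real.pi * |z.im|) / (1 + |‖z‖ - m|) := by gcongr
  have j2 : 2 * Real.exp (Real.pi * |z.im|) / (1 + ‖z + m‖)
      ≤ 2 * Real.exp (Real.pi * |z.im|) / (1 + |‖z‖ - m|) := by gcongr
  calc ‖sinc (z - m) + sinc (z + m)‖ ≤ ‖sinc (z - m)‖ + ‖sinc (z + m)‖ := norm_add_le _ _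
    _ ≤ 2 * Real.exp (Real.pi * |z.im|) / (1 + |‖z‖ - m|)
        + 2 * Real.exp (Real.pi * |z.im|) / (1 + |‖z‖ - m|) := by linarith
    _ = _ := by ring

lemma ConvergesAsCardinalSeries.differentiable {u : ℕ → ℂ → ℂ} {F : ℂ → ℂ}
    (h : ConvergesAsCardinalSeries u F) (hu : ∀ n, Differentiable ℂ (u n)) :
    Differentiable ℂ F := by
  rw [← differentiableOn_univ]
  refine TendstoLocallyUniformlyOn.differentiableOn
    (F := fun N ρ => ∑ n ∈ Finset.range N, u n ρ) (φ := atTop) ?_ ?_ isOpen_univ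
  · rw [tendstoLocallyUniformlyOn_iff_forall_isCompact isOpen_univ]
    exact fun K _ hK => h.uniformly_on_compacts K hK
  · exact Eventually.of_forall fun N =>
      (Differentiable.fun_sum fun n _ => hu n).differentiableOn

/-- The cardinal series of an even entire function of exponential type `π` that decays like
`1 / |z|`, sampled at the numbers `± ν n`. -/
theorem eq_tsum_sinc {F : ℂ → ℂ} (hF : Differentiable ℂ F) (heven : ∀ z, F (-z) = F z) {C : ℝ}
    (hb : ∀ z, ‖F z‖ ≤ C * Real.exp (Real.pi * |z.im|) / (1 + ‖z‖))
    {ν : ℕ → ℕ} (hν : ν.Injective) (hle : ∀ n, n ≤ ν n)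
    (hzero : ∀ k : ℕ, (∀ n, ν n ≠ k) → F k = 0)
    {c : ℕ → ℂ} (hc : ∀ n, c n = if ν n = 0 then F 0 / 2 else F (ν n)) :
    (∀ n, ‖c n‖ ≤ C / (ν n + 1)) ∧
    ∀ z, F z = ∑' n, c n * (sinc (z - ν n) + sinc (z + ν n)) := by
  have hC : 0 ≤ C := by
    have := (norm_nonneg _).trans (hb 0)
    simpa using this
  have hcb : ∀ n, ‖c n‖ ≤ C / (ν n + 1) := by
    intro n
    have h1 := hb (ν n)
    simp only [Complex.natCast_im, abs_zero, mul_zero, Real.exp_zero, mul_one,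
      Complex.norm_natCast] at h1
    rw [add_comm (1 : ℝ)] at h1
    rw [hc]
    split_ifs with h0
    · rw [h0, Nat.cast_zero] at h1
      rw [h0, norm_div, Complex.norm_ofNat, Nat.cast_zero]
      have := norm_nonneg (F 0)
      linarith
    · exact h1
  refine ⟨hcb, fun z => ?_⟩
  set u : ℕ → ℂ → ℂ := fun n z => c n * (sinc (z - ν n) + sinc (z + ν n)) with hu
  have hud : ∀ n, Differentiable ℂ (u n) := fun n =>
    ((differentiable_sinc.comp (differentiable_id.sub_const _)).add
      (differentiable_sinc.comp (differentiable_id.add_const _))).const_mul _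
  have hub : ∀ n z, ‖u n z‖ ≤ 4 * C * Real.exp (Real.pi * |z.im|)
      / ((ν n + 1) * (1 + |1 * ‖z‖ - ν n|)) := by
    intro n z
    rw [hu, norm_mul, one_mul]
    calc ‖c n‖ * ‖sinc (z - ν n) + sinc (z + ν n)‖
        ≤ C / (ν n + 1) * (4 * Real.exp (Real.pi * |z.im|) / (1 + |‖z‖ - ν n|)) := by
          gcongr
          · exact hcb n
          · exact norm_sinc_sub_add_sinc_add_le z (ν n)
      _ = _ := by rw [div_mul_div_comm]; ring
  have hconv := convergesAsCardinalSeries_of_bound hν hle one_pos Real.pi_pos.le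
    (fun n => (hud n).continuous) hub
  obtain ⟨D, hD, htail⟩ := exists_tail_bound hν hle one_pos hub
  have hSd := hconv.differentiable hud
  -- `F` decays with exponent `1` and the series with `5 / 8`; both are weakened to the common
  -- exponent `1 / 8`.
  have hG := eq_zero_of_zero_at_int (hF.sub hSd) (C := C + D) (fun z => ?_) (fun k => ?_) z
  · exact sub_eq_zero.1 hG
  · have h1 := (htail z).2 0
    simp only [Finset.range_zero, Finset.sum_empty, zero_sub, norm_neg, Nat.cast_zero, zero_add,
      Real.one_rpow, mul_one, one_mul] at h1
    have hz1 : 1 ≤ 1 + ‖z‖ := by linarith [norm_nonneg z]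
    have h2 : (1 + ‖z‖) ^ (-(5 / 8) : ℝ) ≤ (1 + ‖z‖) ^ (-(1 / 8) : ℝ) :=
      Real.rpow_le_rpow_of_exponent_le hz1 (by norm_num)
    have h3 : (1 + ‖z‖)⁻¹ ≤ (1 + ‖z‖) ^ (-(1 / 8) : ℝ) := by
      rw [← Real.rpow_neg_one]
      exact Real.rpow_le_rpow_of_exponent_le hz1 (by norm_num)
    calc ‖F z - ∑' n, u n z‖ ≤ ‖F z‖ + ‖∑' n, u n z‖ := norm_sub_le _ _
      _ ≤ C * Real.exp (Real.pi * |z.im|) * (1 + ‖z‖)⁻¹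
          + D * Real.exp (Real.pi * |z.im|) * (1 + ‖z‖) ^ (-(5 / 8) : ℝ) :=
          add_le_add (by simpa only [div_eq_mul_inv] using hb z) h1
      _ ≤ C * Real.exp (Real.pi * |z.im|) * (1 + ‖z‖) ^ (-(1 / 8) : ℝ)
          + D * Real.exp (Real.pi * |z.im|) * (1 + ‖z‖) ^ (-(1 / 8) : ℝ) := by gcongr
      _ = _ := by ring
  · have hnat : ∀ k : ℕ, F k = ∑' n, u n k := by
      intro k
      have hne : ∀ n, ν n ≠ k → u n k = 0 := by
        intro n hn
        have h1 : sinc ((k : ℂ) - ν n) = 0 := by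
          have := sinc_intCast (k := (k : ℤ) - ν n)
            (sub_ne_zero.2 fun h => hn (Int.ofNat_inj.1 h).symm)
          push_cast at this
          exact this
        have h2 : sinc ((k : ℂ) + ν n) = 0 := by
          have := sinc_intCast (k := (k : ℤ) + ν n) (by omega)
          push_cast at this
          exact this
        simp [hu, h1, h2]
      by_cases hk : ∃ n, ν n = k
      · obtain ⟨n, hn⟩ := hk
        rw [tsum_eq_single n fun m hm => hne m fun h => hm (hν (h.trans hn.symm))]
        simp only [hu]
        rw [hc, hn]
        -- At the node `0` both members of the pair equal one, hence the halved coefficient.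
        split_ifs with h0
        · simp only [h0, Nat.cast_zero, sub_self, add_zero, sinc_zero]; ring
        · have h2 : sinc ((k : ℂ) + k) = 0 := by
            have := sinc_intCast (k := (k : ℤ) + k) (by omega)
            push_cast at this
            exact this
          rw [sub_self, sinc_zero, h2]; ring
      · push Not at hk
        rw [hzero k hk]
        exact ((tsum_congr fun n => hne n (hk n)).trans tsum_zero).symm
    have hueven : ∀ n z, u n (-z) = u n z := by
      intro n z
      have e1 : sinc (-z - ν n) = sinc (z + ν n) := by rw [← sinc_neg]; congr 1; ring
      have e2 : sinc (-z + ν n) = sinc (z - ν n) := by rw [← sinc_neg]; congr 1; ring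
      simp only [hu, e1, e2]; ring
    rw [Pi.sub_apply, sub_eq_zero]
    obtain ⟨j, rfl | rfl⟩ := k.eq_nat_or_neg
    · simpa using hnat j
    · have h1 := hnat j
      rw [← heven] at h1
      simp only [← hueven _ (j : ℂ)] at h1
      simpa using h1

end Sampling

/-! ### Rescaled cardinal series. -/

section Scaled

variable {b : ℝ} {ν : ℕ → ℕ}

lemma abs_im_ofReal_mul (b : ℝ) (ρ : ℂ) : |((b : ℂ) * ρ).im| = |b| * |ρ.im| := by
  rw [Complex.im_ofReal_mul, abs_mul]

lemma norm_ofReal_mul (b : ℝ) (ρ : ℂ) : ‖(b : ℂ) * ρ‖ = |b| * ‖ρ‖ := by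
  rw [norm_mul, Complex.norm_real, Real.norm_eq_abs]

/-- Scaled cardinal series with coefficients of order `1 / ν n`. -/
lemma convergesAsCardinalSeries_sinc (hb : b ≠ 0) (hν : ν.Injective) (hle : ∀ n, n ≤ ν n)
    {c : ℕ → ℂ} {C : ℝ} (hc : ∀ n, ‖c n‖ ≤ C / (ν n + 1)) :
    ConvergesAsCardinalSeries
      (fun n ρ => c n * (sinc ((b : ℂ) * ρ - ν n) + sinc ((b : ℂ) * ρ + ν n)))
      (fun ρ => ∑' n, c n * (sinc ((b : ℂ) * ρ - ν n) + sinc ((b : ℂ) * ρ + ν n))) := by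
  refine convergesAsCardinalSeries_of_bound (C := 4 * C) (A := Real.pi * |b|) (β := |b|) hν hle
    (abs_pos.2 hb) (by positivity) (fun n => ?_) (fun n ρ => ?_)
  · have := differentiable_sinc.continuous
    fun_prop
  · have h0 : 0 ≤ C / (ν n + 1) := (norm_nonneg _).trans (hc n)
    rw [norm_mul]
    calc ‖c n‖ * ‖sinc ((b : ℂ) * ρ - ν n) + sinc ((b : ℂ) * ρ + ν n)‖
        ≤ C / (ν n + 1) * (4 * Real.exp (Real.pi * |((b : ℂ) * ρ).im|)
          / (1 + |‖(b : ℂ) * ρ‖ - ν n|)) := by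
          gcongr
          · exact hc n
          · exact norm_sinc_sub_add_sinc_add_le _ (ν n)
      _ = _ := by
          rw [abs_im_ofReal_mul, norm_ofReal_mul, div_mul_div_comm, mul_assoc Real.pi]
          ring

end Scaled

/-! ### Removable singularities and divisibility of the pairs. -/

section Removable

lemma limitValue_eq {f g : ℂ → ℂ} {z : ℂ} (hg : ContinuousAt g z) (h : g =ᶠ[𝓝[≠] z] f) :
    limitValue f z = g z :=
  ((hg.tendsto.mono_left nhdsWithin_le_nhds).congr' h).limUnder_eq

lemma eventually_ne_zero_and_sin_ne_zero {b : ℂ} (hb : b ≠ 0) (ρ : ℂ) :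
    ∀ᶠ z in 𝓝[≠] ρ, z ≠ 0 ∧ Complex.sin (z * b) ≠ 0 := by
  have h1 : ∀ᶠ z in 𝓝[≠] ρ, z ≠ 0 := (hasDerivAt_id ρ).eventually_ne one_ne_zero
  refine h1.and ?_
  by_cases h0 : Complex.sin (ρ * b) = 0
  · have hd : HasDerivAt (fun z => Complex.sin (z * b)) (Complex.cos (ρ * b) * (1 * b)) ρ :=
      ((hasDerivAt_id ρ).mul_const b).csin
    refine hd.eventually_ne (mul_ne_zero (fun hc => ?_) (by simpa using hb))
    have := Complex.sin_sq_add_cos_sq (ρ * b)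
    rw [hc, h0] at this
    simp at this
  · have hc : ContinuousAt (fun z => Complex.sin (z * b)) ρ := by fun_prop
    exact (hc.eventually_ne h0).filter_mono nhdsWithin_le_nhds

lemma eq_of_eventuallyEq_punctured {f g : ℂ → ℂ} {z : ℂ} (hf : ContinuousAt f z)
    (hg : ContinuousAt g z) (h : f =ᶠ[𝓝[≠] z] g) : f z = g z :=
  tendsto_nhds_unique ((hf.tendsto.mono_left nhdsWithin_le_nhds).congr' h)
    (hg.tendsto.mono_left nhdsWithin_le_nhds)

lemma sin_mul_eq_mul_sinc (z b : ℂ) :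
    Complex.sin (z * b) = z * (b * sinc (z * b / Real.pi)) := by
  have hpi : (Real.pi : ℂ) ≠ 0 := Complex.ofReal_ne_zero.2 Real.pi_ne_zero
  have h := pi_mul_mul_sinc (z * b / Real.pi)
  rw [mul_div_cancel₀ _ hpi] at h
  rw [← h]; ring

lemma limitValue_sin_div {b : ℂ} (hb : b ≠ 0) (ρ : ℂ) :
    limitValue (fun z => Complex.sin (z * b) / z) ρ = b * sinc (ρ * b / Real.pi) := by
  refine limitValue_eq (g := fun z => b * sinc (z * b / Real.pi)) ?_ ?_
  · have := differentiable_sinc.continuous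
    exact Continuous.continuousAt (by fun_prop)
  · filter_upwards [eventually_ne_zero_and_sin_ne_zero hb ρ] with z hz
    rw [sin_mul_eq_mul_sinc]
    field_simp [hz.1]

lemma sinc_two_mul (z : ℂ) : sinc (2 * z) = sinc z * Complex.cos (Real.pi * z) := by
  have hpi : (Real.pi : ℂ) ≠ 0 := Complex.ofReal_ne_zero.2 Real.pi_ne_zero
  by_cases h : z = 0
  · simp [h, sinc_zero]
  · have h1 := pi_mul_mul_sinc (2 * z)
    have h2 := pi_mul_mul_sinc z
    rw [show (Real.pi : ℂ) * (2 * z) = 2 * (Real.pi * z) by ring, Complex.sin_two_mul] at h1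
    have h3 : 2 * ((Real.pi : ℂ) * z) ≠ 0 := by simp [h, hpi]
    apply mul_left_cancel₀ h3
    rw [h1, ← h2]; ring

lemma sin_nat_add_half_mul_pi (n : ℕ) :
    Complex.sin ((2 * n + 1) / 2 * Real.pi) = (-1) ^ n := by
  rw [show ((2 * n + 1) / 2 * Real.pi : ℂ) = Real.pi / 2 + n * Real.pi by ring,
    Complex.sin_antiperiodic.add_nat_mul_eq, Complex.sin_pi_div_two, mul_one]

lemma cos_nat_add_half_mul_pi (n : ℕ) :
    Complex.cos ((2 * n + 1) / 2 * Real.pi) = 0 := by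
  rw [show ((2 * n + 1) / 2 * Real.pi : ℂ) = Real.pi / 2 + n * Real.pi by ring,
    Complex.cos_antiperiodic.add_nat_mul_eq, Complex.cos_pi_div_two, mul_zero]

/-- A pair of cardinal functions at odd nodes is divisible by `w sin (π w / 2)`. -/
lemma sinc_sub_add_sinc_add_odd (w : ℂ) (n : ℕ) :
    sinc (w - (2 * n + 1)) + sinc (w + (2 * n + 1))
      = w * Complex.sin (Real.pi * w / 2) * ((-1) ^ n / (2 * n + 1)
        * (sinc ((w - (2 * n + 1)) / 2) + sinc ((w + (2 * n + 1)) / 2))) := by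
  have hpi : (Real.pi : ℂ) ≠ 0 := Complex.ofReal_ne_zero.2 Real.pi_ne_zero
  have hm : (2 * n + 1 : ℂ) ≠ 0 := by exact_mod_cast (by omega : 2 * n + 1 ≠ 0)
  have hs := sin_nat_add_half_mul_pi n
  have hc := cos_nat_add_half_mul_pi n
  have e1 : sinc (w - (2 * n + 1)) = sinc ((w - (2 * n + 1)) / 2)
      * ((-1) ^ n * Complex.sin (Real.pi * w / 2)) := by
    have := sinc_two_mul ((w - (2 * n + 1)) / 2)
    rw [mul_div_cancel₀ _ two_ne_zero] at this
    rw [this, show (Real.pi : ℂ) * ((w - (2 * n + 1)) / 2)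
      = Real.pi * w / 2 - (2 * n + 1) / 2 * Real.pi by ring, Complex.cos_sub, hs, hc]
    ring
  have e2 : sinc (w + (2 * n + 1)) = -(sinc ((w + (2 * n + 1)) / 2)
      * ((-1) ^ n * Complex.sin (Real.pi * w / 2))) := by
    have := sinc_two_mul ((w + (2 * n + 1)) / 2)
    rw [mul_div_cancel₀ _ two_ne_zero] at this
    rw [this, show (Real.pi : ℂ) * ((w + (2 * n + 1)) / 2)
      = Real.pi * w / 2 + (2 * n + 1) / 2 * Real.pi by ring, Complex.cos_add, hs, hc]
    ring
  have h1 := pi_mul_mul_sinc ((w - (2 * n + 1)) / 2)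
  have h2 := pi_mul_mul_sinc ((w + (2 * n + 1)) / 2)
  rw [show (Real.pi : ℂ) * ((w - (2 * n + 1)) / 2)
      = Real.pi * w / 2 - (2 * n + 1) / 2 * Real.pi by ring, Complex.sin_sub, hs, hc] at h1
  rw [show (Real.pi : ℂ) * ((w + (2 * n + 1)) / 2)
      = Real.pi * w / 2 + (2 * n + 1) / 2 * Real.pi by ring, Complex.sin_add, hs, hc] at h2
  -- The sines of the two half arguments are opposite. Hence the difference of the two `sinc` values
  -- left after extracting `sin (π w / 2)` is `w / (2 n + 1)` times their sum, which yields the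
  -- factor `w`.
  have key : (w - (2 * n + 1)) * sinc ((w - (2 * n + 1)) / 2)
      + (w + (2 * n + 1)) * sinc ((w + (2 * n + 1)) / 2) = 0 := by
    apply mul_left_cancel₀ hpi
    linear_combination 2 * h1 + 2 * h2
  rw [e1, e2]
  generalize sinc ((w - (2 * n + 1)) / 2) = P at key ⊢
  generalize sinc ((w + (2 * n + 1)) / 2) = Q at key ⊢
  generalize Complex.sin (Real.pi * w / 2) = S
  field_simp
  linear_combination -S * key

end Removable

/-! ### The expansion of `ψ`. -/

section Psi

variable {q : ℝ → ℂ} {L x : ℝ} {H : ℂ} {T ψ : ℂ → ℝ → ℂ}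

lemma mul_sphericalJ1 {b : ℝ} (hb : b ≠ 0) (ρ : ℂ) :
    ρ * (b : ℂ) * sphericalJ1 (ρ * (-b : ℂ))
      = Complex.cos (ρ * b) - sinc (b / Real.pi * ρ) := by
  have hpi : (Real.pi : ℂ) ≠ 0 := Complex.ofReal_ne_zero.2 Real.pi_ne_zero
  have hb' : (b : ℂ) ≠ 0 := Complex.ofReal_ne_zero.2 hb
  by_cases h : ρ = 0
  · simp [h, sinc_zero]
  · have h1 : ρ * (-b : ℂ) ≠ 0 := mul_ne_zero h (neg_ne_zero.2 hb')
    have h2 : (b : ℂ) / Real.pi * ρ ≠ 0 := mul_ne_zero (div_ne_zero hb' hpi) h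
    rw [sphericalJ1, if_neg h1, sinc, if_neg h2,
      show (Real.pi : ℂ) * (b / Real.pi * ρ) = ρ * b by field_simp, mul_neg, Complex.sin_neg,
      Complex.cos_neg]
    field_simp
    ring

lemma psi_series (hL : 0 < L) (hq : MemLp q 2 (volume.restrict (Icc 0 L)))
    (hT : IsSolutionT q L T) (hψ : IsSolutionPsi q L H ψ) (hx : x ∈ Ico 0 L) :
    (∃ C : ℝ, ∀ n, ‖coeffPsi L ψ n x‖ ≤ C / (n + 1)) ∧
    ∀ ρ : ℂ, ψ ρ x = Complex.cos (ρ * (x - L : ℝ)) - sinc (((x - L : ℝ) : ℂ) / Real.pi * ρ)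
      + ∑' n : ℕ, coeffPsi L ψ n x * (sinc (((x - L : ℝ) : ℂ) / Real.pi * ρ - n)
        + sinc (((x - L : ℝ) : ℂ) / Real.pi * ρ + n)) := by
  have hx' : x ∈ Icc 0 L := Ico_subset_Icc_self hx
  have hpi : (Real.pi : ℂ) ≠ 0 := Complex.ofReal_ne_zero.2 Real.pi_ne_zero
  set b : ℝ := x - L with hb
  have hb0 : b < 0 := sub_neg.2 hx.2
  have hbC : (b : ℂ) ≠ 0 := Complex.ofReal_ne_zero.2 hb0.ne
  have hbC' : (x : ℂ) - L = b := by rw [hb]; push_cast; ring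
  obtain ⟨C, hC, hbound⟩ := exists_psi_bound hL hq hψ hx'
  rw [show L - x = -b by rw [hb]; ring] at hbound
  rw [hbC'] at hbound
  set s : ℝ := Real.pi / b with hs
  -- The scale makes `ρ b = π z`. The added `sinc` cancels the cosine at `z = 0`, so that `F 0 = ψ 0
  -- x`, and changes no other integer sample.
  set F : ℂ → ℂ := fun z => ψ ((s : ℂ) * z) x - Complex.cos (Real.pi * z) + sinc z with hF
  have hsb : ∀ z : ℂ, (s : ℂ) * z * b = Real.pi * z := by
    intro z; rw [hs]; push_cast; field_simp
  have hFd : Differentiable ℂ F := by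
    have h1 := differentiable_solution hL hq hT hψ hψ hx'
    have h2 : Differentiable ℂ (fun z : ℂ => ψ ((s : ℂ) * z) x) :=
      h1.comp (differentiable_id.const_mul _)
    exact (h2.sub (Complex.differentiable_cos.comp (differentiable_id.const_mul _))).add
      differentiable_sinc
  have hFe : ∀ z, F (-z) = F z := by
    intro z
    simp only [hF]
    rw [mul_neg, mul_neg, solution_neg hL hT hψ hψ _ hx', Complex.cos_neg, sinc_neg]
  have hFb : ∀ z, ‖F z‖ ≤ (C * (1 + |b|) + 2) * Real.exp (Real.pi * |z.im|) / (1 + ‖z‖) := by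
    intro z
    have h1 := hbound (s * z)
    rw [hsb, abs_im_ofReal_mul, norm_ofReal_mul] at h1
    have e1 : |s| * |z.im| * -b = Real.pi * |z.im| := by
      rw [hs, abs_div, abs_of_pos Real.pi_pos, ← abs_of_neg hb0]
      field_simp [abs_ne_zero.2 hb0.ne]
    rw [e1] at h1
    have e2 : 1 + ‖z‖ ≤ (1 + |b|) * (1 + |s| * ‖z‖) := by
      have h3 : |b| * |s| = Real.pi := by
        rw [← abs_mul, hs, mul_div_cancel₀ _ hb0.ne, abs_of_pos Real.pi_pos]
      nlinarith [norm_nonneg z, abs_nonneg b, abs_nonneg s, Real.pi_gt_three,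
        mul_nonneg (abs_nonneg s) (norm_nonneg z)]
    have e3 : C * Real.exp (Real.pi * |z.im|) / (1 + |s| * ‖z‖)
        ≤ C * (1 + |b|) * Real.exp (Real.pi * |z.im|) / (1 + ‖z‖) := by
      rw [div_le_div_iff₀ (by positivity) (by positivity)]
      have := mul_le_mul_of_nonneg_left e2
        (show 0 ≤ C * Real.exp (Real.pi * |z.im|) by positivity)
      linarith
    calc ‖F z‖ ≤ ‖ψ ((s : ℂ) * z) x - Complex.cos (Real.pi * z)‖ + ‖sinc z‖ := norm_add_le _ _
      _ ≤ C * (1 + |b|) * Real.exp (Real.pi * |z.im|) / (1 + ‖z‖)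
          + 2 * Real.exp (Real.pi * |z.im|) / (1 + ‖z‖) :=
          add_le_add (h1.trans e3) (norm_sinc_le z)
      _ = _ := by ring
  obtain ⟨hcb, hsum⟩ := eq_tsum_sinc hFd hFe hFb (ν := id) Function.injective_id
    (fun n => le_rfl) (fun k hk => absurd rfl (hk k)) (c := fun n => coeffPsi L ψ n x)
    (fun n => by
      simp only [coeffPsi, id, hF, hbC']
      split_ifs with h0
      · simp [sinc_zero]
      · have h1 : sinc (n : ℂ) = 0 := by
          have := sinc_intCast (k := n) (by exact_mod_cast h0)
          exact_mod_cast this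
        rw [h1, mul_comm (Real.pi : ℂ), ← zero_add ((n : ℂ) * Real.pi),
          Complex.cos_antiperiodic.add_nat_mul_eq, Complex.cos_zero, mul_one, zero_add, add_zero,
          show (s : ℂ) * n = n * Real.pi / b by rw [hs]; push_cast; ring])
  refine ⟨⟨_, hcb⟩, fun ρ => ?_⟩
  have h := hsum (b / Real.pi * ρ)
  simp only [id] at h
  rw [← h]
  simp only [hF]
  rw [show (s : ℂ) * (b / Real.pi * ρ) = ρ by rw [hs]; push_cast; field_simp,
    show (Real.pi : ℂ) * (b / Real.pi * ρ) = ρ * b by field_simp]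
  ring

end Psi

/-! ### The expansion of `T` and its divided terms. -/

section T

variable {q : ℝ → ℂ} {L x : ℝ} {H : ℂ} {T ψ : ℂ → ℝ → ℂ}

lemma T_series (hL : 0 < L) (hq : MemLp q 2 (volume.restrict (Icc 0 L)))
    (hT : IsSolutionT q L T) (hψ : IsSolutionPsi q L H ψ) (hx : x ∈ Ico 0 L) :
    (∃ C : ℝ, ∀ n : ℕ, ‖coeffT L T n x‖ ≤ C / ((2 * n + 1 : ℕ) + 1)) ∧
    ∀ ρ : ℂ, 2 * ρ * Complex.sin (ρ * (x - L : ℝ)) * T ρ x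
      = 2 * Complex.sin (ρ * (x - L : ℝ)) ^ 2
      + ∑' n : ℕ, coeffT L T n x * (sinc (((2 * (x - L) / Real.pi : ℝ) : ℂ) * ρ - (2 * n + 1 : ℕ))
        + sinc (((2 * (x - L) / Real.pi : ℝ) : ℂ) * ρ + (2 * n + 1 : ℕ))) := by
  have hx' : x ∈ Icc 0 L := Ico_subset_Icc_self hx
  have hpi : (Real.pi : ℂ) ≠ 0 := Complex.ofReal_ne_zero.2 Real.pi_ne_zero
  set b : ℝ := x - L with hb
  have hb0 : b < 0 := sub_neg.2 hx.2
  have hbC : (b : ℂ) ≠ 0 := Complex.ofReal_ne_zero.2 hb0.ne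
  have hbC' : (x : ℂ) - L = b := by rw [hb]; push_cast; ring
  obtain ⟨C, hC, hbound⟩ := exists_T_bound hL hq hT hx'
  rw [show L - x = -b by rw [hb]; ring] at hbound
  rw [hbC'] at hbound
  set s : ℝ := Real.pi / (2 * b) with hs
  -- Now `ρ b = π z / 2`, so each of the two factors has type `π / 2` and the product has type `π`.
  -- The sine vanishes at even integers and is `(-1) ^ n` at `2 n + 1`, where `F` takes the value
  -- `coeffT`.
  set F : ℂ → ℂ := fun z => 2 * Complex.sin ((s : ℂ) * z * b)
    * ((s : ℂ) * z * T ((s : ℂ) * z) x - Complex.sin ((s : ℂ) * z * b)) with hF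
  have hsb : ∀ z : ℂ, (s : ℂ) * z * b = Real.pi * z / 2 := by
    intro z; rw [hs]; push_cast; field_simp
  have hFd : Differentiable ℂ F := by
    have h1 := differentiable_solution hL hq hT hψ hT hx'
    have h2 : Differentiable ℂ (fun z : ℂ => T ((s : ℂ) * z) x) :=
      h1.comp (differentiable_id.const_mul _)
    fun_prop
  have hFe : ∀ z, F (-z) = F z := by
    intro z
    simp only [hF]
    rw [mul_neg, solution_neg hL hT hψ hT _ hx', neg_mul, Complex.sin_neg]
    ring
  have hFb : ∀ z, ‖F z‖ ≤ (2 * C * (1 + |b|)) * Real.exp (Real.pi * |z.im|) / (1 + ‖z‖) := by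
    intro z
    have h1 := hbound (s * z)
    have h2 := norm_sin_le_exp ((s : ℂ) * z * b)
    have him : ((s : ℂ) * z * b).im = Real.pi / 2 * z.im := by
      rw [hsb, show (Real.pi : ℂ) * z / 2 = ((Real.pi / 2 : ℝ) : ℂ) * z by push_cast; ring,
        Complex.im_ofReal_mul]
    rw [him, abs_mul, abs_of_pos Real.pi_div_two_pos] at h2
    rw [abs_im_ofReal_mul, norm_ofReal_mul] at h1
    have e1 : |s| * |z.im| * -b = Real.pi / 2 * |z.im| := by
      rw [hs, abs_div, abs_mul, abs_two, abs_of_pos Real.pi_pos, ← abs_of_neg hb0]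
      field_simp [abs_ne_zero.2 hb0.ne]
    rw [e1] at h1
    have e2 : 1 + ‖z‖ ≤ (1 + |b|) * (1 + |s| * ‖z‖) := by
      have h3 : |b| * |s| = Real.pi / 2 := by
        rw [← abs_mul, hs, ← abs_of_pos Real.pi_div_two_pos]
        congr 1
        field_simp [hb0.ne]
      nlinarith [norm_nonneg z, abs_nonneg b, abs_nonneg s, Real.pi_gt_three,
        mul_nonneg (abs_nonneg s) (norm_nonneg z)]
    have e3 : C * Real.exp (Real.pi / 2 * |z.im|) / (1 + |s| * ‖z‖)
        ≤ C * (1 + |b|) * Real.exp (Real.pi / 2 * |z.im|) / (1 + ‖z‖) := by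
      rw [div_le_div_iff₀ (by positivity) (by positivity)]
      have := mul_le_mul_of_nonneg_left e2
        (show 0 ≤ C * Real.exp (Real.pi / 2 * |z.im|) by positivity)
      linarith
    simp only [hF]
    rw [norm_mul, norm_mul, Complex.norm_ofNat]
    calc 2 * ‖Complex.sin ((s : ℂ) * z * b)‖ * _
        ≤ 2 * Real.exp (Real.pi / 2 * |z.im|)
          * (C * (1 + |b|) * Real.exp (Real.pi / 2 * |z.im|) / (1 + ‖z‖)) := by
          gcongr
          exact h1.trans e3
      _ = 2 * C * (1 + |b|) * (Real.exp (Real.pi / 2 * |z.im|) * Real.exp (Real.pi / 2 * |z.im|))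
          / (1 + ‖z‖) := by ring
      _ = _ := by rw [← Real.exp_add]; ring_nf
  have hinj : Function.Injective (fun n : ℕ => 2 * n + 1) := fun m n h => by
    simpa using h
  obtain ⟨hcb, hsum⟩ := eq_tsum_sinc hFd hFe hFb (ν := fun n => 2 * n + 1) hinj
    (fun n => by omega)
    (fun k hk => by
      obtain ⟨j, rfl | rfl⟩ := k.even_or_odd'
      · have h1 : Complex.sin ((s : ℂ) * (2 * j : ℕ) * b) = 0 := by
          rw [hsb, show (Real.pi : ℂ) * (2 * j : ℕ) / 2 = j * Real.pi by push_cast; ring,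
            Complex.sin_nat_mul_pi]
        simp only [hF, h1, mul_zero, zero_mul]
      · exact absurd rfl (hk j))
    (c := fun n => coeffT L T n x)
    (fun n => by
      rw [if_neg (by omega)]
      have h1 : Complex.sin ((s : ℂ) * (2 * n + 1 : ℕ) * b) = (-1) ^ n := by
        rw [hsb, ← sin_nat_add_half_mul_pi]
        congr 1; push_cast; ring
      have h2 : (s : ℂ) * (2 * n + 1 : ℕ) = (2 * n + 1) / (2 * b) * Real.pi := by
        rw [hs]; push_cast; ring
      have h3 : ((-1 : ℂ) ^ n) * (-1) ^ n = 1 := by rw [← mul_pow]; simp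
      simp only [hF, coeffT, hbC', h1]
      rw [h2]
      generalize (-1 : ℂ) ^ n = ε at h3 ⊢
      generalize T ((2 * n + 1) / (2 * b) * Real.pi) x = τ
      field_simp
      linear_combination 2 * (b : ℂ) * h3)
  refine ⟨⟨_, hcb⟩, fun ρ => ?_⟩
  have h := hsum (((2 * b / Real.pi : ℝ) : ℂ) * ρ)
  rw [← h]
  simp only [hF]
  rw [show (s : ℂ) * (((2 * b / Real.pi : ℝ) : ℂ) * ρ) = ρ by rw [hs]; push_cast; field_simp]
  ring

/-- The terms of the series for `T` with the factor `1 / (2 ρ sin (ρ (x - L)))` included, as entire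
functions. -/
noncomputable def dividedPairT (L x : ℝ) (n : ℕ) (ρ : ℂ) : ℂ :=
  (x - L) / Real.pi * ((-1) ^ n / (2 * n + 1)
    * (sinc ((((2 * (x - L) / Real.pi : ℝ) : ℂ) * ρ - (2 * n + 1)) / 2)
      + sinc ((((2 * (x - L) / Real.pi : ℝ) : ℂ) * ρ + (2 * n + 1)) / 2)))

lemma continuous_dividedPairT (L x : ℝ) (n : ℕ) : Continuous (dividedPairT L x n) := by
  have := differentiable_sinc.continuous
  unfold dividedPairT
  fun_prop

lemma sincPairT_eq_sinc (L x : ℝ) (n : ℕ) (ρ : ℂ) :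
    sincPairT L x n ρ = sinc (((2 * (x - L) / Real.pi : ℝ) : ℂ) * ρ - (2 * n + 1 : ℕ))
      + sinc (((2 * (x - L) / Real.pi : ℝ) : ℂ) * ρ + (2 * n + 1 : ℕ)) := by
  unfold sincPairT
  push_cast
  congr 2 <;> ring

lemma sincPairT_eq_mul (L x : ℝ) (n : ℕ) (ρ : ℂ) :
    sincPairT L x n ρ = 2 * ρ * Complex.sin (ρ * (x - L)) * dividedPairT L x n ρ := by
  have hpi : (Real.pi : ℂ) ≠ 0 := Complex.ofReal_ne_zero.2 Real.pi_ne_zero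
  rw [sincPairT_eq_sinc]
  push_cast
  rw [sinc_sub_add_sinc_add_odd, dividedPairT]
  push_cast
  rw [show (Real.pi : ℂ) * (2 * (x - L) / Real.pi * ρ) / 2 = ρ * (x - L) by field_simp]
  ring

lemma limitValue_sincPairT {L x : ℝ} (hx : x < L) (n : ℕ) (ρ : ℂ) :
    limitValue (fun z => sincPairT L x n z / (2 * z * Complex.sin (z * (x - L)))) ρ
      = dividedPairT L x n ρ := by
  have hb : (x : ℂ) - L ≠ 0 := by
    rw [← Complex.ofReal_sub]; exact Complex.ofReal_ne_zero.2 (sub_neg.2 hx).ne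
  refine limitValue_eq (continuous_dividedPairT L x n).continuousAt ?_
  filter_upwards [eventually_ne_zero_and_sin_ne_zero hb ρ] with z hz
  rw [sincPairT_eq_mul, mul_div_cancel_left₀]
  exact mul_ne_zero (mul_ne_zero two_ne_zero hz.1) hz.2

lemma norm_sinc_half_le (z : ℂ) :
    ‖sinc (z / 2)‖ ≤ 4 * Real.exp (Real.pi * |z.im|) / (1 + ‖z‖) := by
  have h := norm_sinc_le (z / 2)
  have him : (z / 2).im = z.im / 2 := by simp
  rw [him, norm_div, Complex.norm_ofNat, abs_div, abs_two] at h
  refine h.trans ?_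
  rw [div_le_div_iff₀ (by positivity) (by positivity)]
  have h1 : Real.exp (Real.pi * (|z.im| / 2)) ≤ Real.exp (Real.pi * |z.im|) := by
    apply Real.exp_le_exp.2
    have := mul_nonneg Real.pi_pos.le (abs_nonneg z.im)
    linarith
  calc 2 * Real.exp (Real.pi * (|z.im| / 2)) * (1 + ‖z‖)
      ≤ 2 * Real.exp (Real.pi * |z.im|) * (2 * (1 + ‖z‖ / 2)) := by
        gcongr
        linarith [norm_nonneg z]
    _ = _ := by ring

/-- The estimate is deliberately coarse: the factor `1 / (2 n + 1)` and the halved exponential type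
are given up to reach the form that `convergesAsCardinalSeries_of_bound` accepts. -/
lemma norm_dividedPairT_le {L x : ℝ} (n : ℕ) (ρ : ℂ) :
    ‖dividedPairT L x n ρ‖ ≤ 8 * |x - L|
      * Real.exp (Real.pi * |2 * (x - L) / Real.pi| * |ρ.im|)
        / (1 + |(|2 * (x - L) / Real.pi|) * ‖ρ‖ - (2 * n + 1 : ℕ)|) := by
  set β : ℝ := 2 * (x - L) / Real.pi with hβ
  set m : ℕ := 2 * n + 1 with hm
  have hmC : (2 * n + 1 : ℂ) = (m : ℂ) := by rw [hm]; push_cast; ring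
  set z : ℂ := (β : ℂ) * ρ with hz
  have hzn : ‖z‖ = |β| * ‖ρ‖ := norm_ofReal_mul β ρ
  have hzi : |z.im| = |β| * |ρ.im| := abs_im_ofReal_mul β ρ
  have h1 : |‖z‖ - m| ≤ ‖z - m‖ := by
    have := abs_norm_sub_norm_le z (m : ℂ)
    rwa [Complex.norm_natCast] at this
  have h2 : |‖z‖ - m| ≤ ‖z + m‖ := by
    have := abs_norm_sub_norm_le z (-(m : ℂ))
    rwa [norm_neg, Complex.norm_natCast, sub_neg_eq_add] at this
  have i1 := norm_sinc_half_le (z - m)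
  have i2 := norm_sinc_half_le (z + m)
  rw [show (z - m).im = z.im by simp] at i1
  rw [show (z + m).im = z.im by simp] at i2
  have j1 : 4 * Real.exp (Real.pi * |z.im|) / (1 + ‖z - m‖)
      ≤ 4 * Real.exp (Real.pi * |z.im|) / (1 + |‖z‖ - m|) := by gcongr
  have j2 : 4 * Real.exp (Real.pi * |z.im|) / (1 + ‖z + m‖)
      ≤ 4 * Real.exp (Real.pi * |z.im|) / (1 + |‖z‖ - m|) := by gcongr
  have k1 : ‖((x : ℂ) - L) / Real.pi‖ ≤ |x - L| := by
    rw [← Complex.ofReal_sub, norm_div, Complex.norm_real, Complex.norm_real, Real.norm_eq_abs,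
      Real.norm_of_nonneg Real.pi_pos.le]
    exact div_le_self (abs_nonneg _) (by linarith [Real.pi_gt_three])
  have k2 : ‖(-1 : ℂ) ^ n / m‖ ≤ 1 := by
    rw [norm_div, norm_pow, norm_neg, norm_one, one_pow, Complex.norm_natCast]
    refine div_le_one_of_le₀ ?_ (Nat.cast_nonneg _)
    exact_mod_cast (by omega : 1 ≤ m)
  rw [dividedPairT, hmC, norm_mul, norm_mul]
  calc ‖((x : ℂ) - L) / Real.pi‖ * (‖(-1 : ℂ) ^ n / m‖ * ‖sinc ((z - m) / 2) + sinc ((z + m) / 2)‖)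
      ≤ |x - L| * (1 * (4 * Real.exp (Real.pi * |z.im|) / (1 + |‖z‖ - m|)
        + 4 * Real.exp (Real.pi * |z.im|) / (1 + |‖z‖ - m|))) := by
        gcongr
        exact (norm_add_le _ _).trans (add_le_add (i1.trans j1) (i2.trans j2))
    _ = _ := by rw [hzn, hzi, mul_assoc Real.pi]; ring

end T

end SturmLiouville

/-! ### Assembly of the expansions. -/

theorem mainTheorem6 (L : ℝ) (hL : 0 < L) (q : ℝ → ℂ)
    (hq : MemLp q 2 (volume.restrict (Icc 0 L))) (H : ℂ)
    (T ψ : ℂ → ℝ → ℂ)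
    (hT : SturmLiouville.IsSolutionT q L T)
    (hψ : SturmLiouville.IsSolutionPsi q L H ψ)
    (x : ℝ) (hx : x ∈ Ico 0 L) :
    -- the series of `T`, where the denominators do not vanish
    (∀ ρ : ℂ, ρ ≠ 0 → Complex.sin (ρ * (x - L)) ≠ 0 →
      T ρ x = Complex.sin (ρ * (x - L)) / ρ
        + 1 / (2 * ρ * Complex.sin (ρ * (x - L)))
          * ∑' n : ℕ, SturmLiouville.coeffT L T n x * SturmLiouville.sincPairT L x n ρ) ∧
    SturmLiouville.ConvergesAsCardinalSeries
      (fun n ρ => SturmLiouville.coeffT L T n x * SturmLiouville.sincPairT L x n ρ)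
      (fun ρ => ∑' n : ℕ, SturmLiouville.coeffT L T n x * SturmLiouville.sincPairT L x n ρ) ∧
    -- the series of `T` for all `ρ`, quotients being extended to their removable singularities
    (∀ ρ : ℂ,
      T ρ x = SturmLiouville.limitValue (fun z => Complex.sin (z * (x - L)) / z) ρ
        + ∑' n : ℕ, SturmLiouville.coeffT L T n x * SturmLiouville.limitValue
            (fun z => SturmLiouville.sincPairT L x n z
              / (2 * z * Complex.sin (z * (x - L)))) ρ) ∧
    SturmLiouville.ConvergesAsCardinalSeries
      (fun n ρ => SturmLiouville.coeffT L T n x * SturmLiouville.limitValue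
        (fun z => SturmLiouville.sincPairT L x n z / (2 * z * Complex.sin (z * (x - L)))) ρ)
      (fun ρ => T ρ x
        - SturmLiouville.limitValue (fun z => Complex.sin (z * (x - L)) / z) ρ) ∧
    -- the series of `ψ`
    (∀ ρ : ℂ,
      ψ ρ x = ρ * (x - L) * SturmLiouville.sphericalJ1 (ρ * (L - x))
        + ∑' n : ℕ, SturmLiouville.coeffPsi L ψ n x * SturmLiouville.sincPairPsi L x n ρ) ∧
    SturmLiouville.ConvergesAsCardinalSeries
      (fun n ρ => SturmLiouville.coeffPsi L ψ n x * SturmLiouville.sincPairPsi L x n ρ)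
      (fun ρ => ∑' n : ℕ,
        SturmLiouville.coeffPsi L ψ n x * SturmLiouville.sincPairPsi L x n ρ) := by
  open SturmLiouville in
  have hpi : (Real.pi : ℂ) ≠ 0 := Complex.ofReal_ne_zero.2 Real.pi_ne_zero
  have hb0 : x - L ≠ 0 := (sub_neg.2 hx.2).ne
  have hbC : (x : ℂ) - L ≠ 0 := by
    rw [← Complex.ofReal_sub]; exact Complex.ofReal_ne_zero.2 hb0
  have hinj : Function.Injective (fun n : ℕ => 2 * n + 1) := fun m n h => by simpa using h
  have hβ : 2 * (x - L) / Real.pi ≠ 0 :=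
    div_ne_zero (mul_ne_zero two_ne_zero hb0) Real.pi_ne_zero
  obtain ⟨⟨C, hC⟩, hTs⟩ := T_series hL hq hT hψ hx
  obtain ⟨⟨C', hC'⟩, hψs⟩ := psi_series hL hq hT hψ hx
  simp only [← sincPairT_eq_sinc, Complex.ofReal_sub] at hTs
  have h1 : ∀ ρ : ℂ, ρ ≠ 0 → Complex.sin (ρ * (x - L)) ≠ 0 →
      T ρ x = Complex.sin (ρ * (x - L)) / ρ
        + 1 / (2 * ρ * Complex.sin (ρ * (x - L)))
          * ∑' n : ℕ, coeffT L T n x * sincPairT L x n ρ := by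
    intro ρ hρ hs
    have h := hTs ρ
    field_simp
    linear_combination h
  have h4 : ConvergesAsCardinalSeries (fun n ρ => coeffT L T n x * dividedPairT L x n ρ)
      (fun ρ => ∑' n, coeffT L T n x * dividedPairT L x n ρ) := by
    refine convergesAsCardinalSeries_of_bound (C := C * (8 * |x - L|))
      (A := Real.pi * |2 * (x - L) / Real.pi|) (β := |2 * (x - L) / Real.pi|)
      (ν := fun n => 2 * n + 1) hinj (fun n => by omega) (abs_pos.2 hβ) (by positivity)
      (fun n => (continuous_dividedPairT L x n).const_smul (coeffT L T n x)) (fun n ρ => ?_)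
    have h0 := (norm_nonneg _).trans (hC n)
    rw [norm_mul]
    refine (mul_le_mul (hC n) (norm_dividedPairT_le n ρ) (norm_nonneg _) h0).trans (le_of_eq ?_)
    rw [div_mul_div_comm]
    ring
  have hdiv : ∀ n, Differentiable ℂ (fun ρ => coeffT L T n x * dividedPairT L x n ρ) := by
    intro n
    have := differentiable_sinc
    unfold dividedPairT
    fun_prop
  have h3 : ∀ ρ : ℂ, T ρ x = ((x : ℂ) - L) * sinc (ρ * (x - L) / Real.pi)
      + ∑' n : ℕ, coeffT L T n x * dividedPairT L x n ρ := by
    intro ρ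
    have hsinc := differentiable_sinc.continuous
    -- Both sides are continuous at every `ρ`, and the zeros of `ρ sin (ρ b)` are isolated, so
    -- agreement near `ρ` off those zeros gives equality at `ρ`.
    refine eq_of_eventuallyEq_punctured (f := fun ρ => T ρ x)
      (g := fun ρ => ((x : ℂ) - L) * sinc (ρ * (x - L) / Real.pi)
        + ∑' n : ℕ, coeffT L T n x * dividedPairT L x n ρ)
      (differentiable_solution hL hq hT hψ hT (Ico_subset_Icc_self hx)).continuous.continuousAt
      (Continuous.continuousAt (Continuous.add (by fun_prop) (h4.differentiable hdiv).continuous))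
      ?_
    filter_upwards [eventually_ne_zero_and_sin_ne_zero hbC ρ] with z hz
    have hz2 : 2 * z * Complex.sin (z * (x - L)) ≠ 0 :=
      mul_ne_zero (mul_ne_zero two_ne_zero hz.1) hz.2
    rw [h1 z hz.1 hz.2, ← tsum_mul_left]
    congr 1
    · rw [sin_mul_eq_mul_sinc, mul_div_cancel_left₀ _ hz.1]
    · refine tsum_congr fun n => ?_
      rw [sincPairT_eq_mul, mul_left_comm (coeffT L T n x), ← mul_assoc, one_div,
        inv_mul_cancel₀ hz2, one_mul]
  have hpsi : ∀ n (ρ : ℂ), sincPairPsi L x n ρ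
      = sinc ((((x - L) / Real.pi : ℝ) : ℂ) * ρ - n)
        + sinc ((((x - L) / Real.pi : ℝ) : ℂ) * ρ + n) := by
    intro n ρ
    unfold sincPairPsi
    push_cast
    congr 2 <;> ring
  refine ⟨h1, ?_, fun ρ => ?_, ?_, fun ρ => ?_, ?_⟩
  · simp only [sincPairT_eq_sinc]
    exact convergesAsCardinalSeries_sinc (ν := fun n => 2 * n + 1) hβ hinj (fun n => by omega) hC
  · simp only [limitValue_sincPairT hx.2, limitValue_sin_div hbC]
    exact h3 ρ
  · simp only [limitValue_sincPairT hx.2, limitValue_sin_div hbC]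
    have e : (fun ρ => T ρ x - ((x : ℂ) - L) * sinc (ρ * (x - L) / Real.pi))
        = fun ρ => ∑' n, coeffT L T n x * dividedPairT L x n ρ := by
      ext ρ
      rw [h3 ρ]; ring
    rw [e]
    exact h4
  · have hj := mul_sphericalJ1 hb0 ρ
    have h := hψs ρ
    simp only [hpsi]
    rw [← hj] at h
    push_cast at h ⊢
    rw [neg_sub] at h
    exact h
  · simp only [hpsi]
    exact convergesAsCardinalSeries_sinc (ν := fun n => n) (div_ne_zero hb0 Real.pi_ne_zero)
      Function.injective_id (fun n => le_rfl) hC'
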